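/- Let \(n\ge 2\) be an integer and let \(p=n\). Let \(a_i\ge 0\) \((i=1,2,\dots)\) with \(\sum_{i=1}^\infty a_i<\infty\), let \(y_i\in\mathbb{R}^n\), and let \(K:\mathbb{R}^n\to\mathbb{R}\) be an arbitrary concave function. We set \(-\ln|x-y_i|:=+\infty\) at \(x=y_i\), and \(0\cdot\infty:=0\). Suppose that the series \(\sum_{i=1}^\infty a_i\ln|x-y_i|\) converges absolutely at some point \(x_0\in\mathbb{R}^n\), that is, \(x_0\ne y_i\) whenever \(a_i>0\), and \(\sum_i a_i\,\bigl|\ln|x_0-y_i|\bigr|<\infty\) (the sum being taken over the indices with \(a_i>0\)). Then for every \(x\in\mathbb{R}^n\) the series \(-\sum_{i=1}^\infty a_i\ln|x-y_i|\) converges unconditionally in \((-\infty,+\infty]\), and \[W(x):=-\sum_{i=1}^\infty a_i\ln|x-y_i|+K(x)\] is \(p\)-superharmonic in \(\mathbb{R}^n\). Here a continuous function \(h\in W^{1,p}_{loc}(D)\) on an open set \(D\subset\mathbb{R}^n\) is called \(p\)-harmonic in \(D\) if \(\int_D|\nabla h|^{p-2}\,\nabla h\cdot\nabla\phi\,dx=0\)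 for all \(\phi\in C_0^\infty(D)\). A function \(u:\mathbb{R}^n\to(-\infty,\infty]\) is called \(p\)-superharmonic in \(\mathbb{R}^n\) if (i) \(u\not\equiv\infty\); (ii) \(u\) is lower semicontinuous; (iii) whenever \(D\subset\mathbb{R}^n\) is a bounded open set and \(h\in C(\overline{D})\) is \(p\)-harmonic in \(D\) with \(h\le u\) on \(\partial D\), then \(h\le u\) in \(D\). -/

import Mathlib

open MeasureTheory
open scoped ContDiff

namespace PLaplace

/-- `φ ∈ C₀^∞(Ω)`: smooth with compact support contained in `Ω`. -/
structure IsTestFunctionOn {n : ℕ} (Ω : Set (EuclideanSpace ℝ (Fin n)))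
    (φ : EuclideanSpace ℝ (Fin n) → ℝ) : Prop where
  contDiff : ContDiff ℝ ∞ φ
  hasCompactSupport : HasCompactSupport φ
  tsupport_subset : tsupport φ ⊆ Ω

/-- `f ∈ L^p_loc(Ω)`: `f` is in `L^p` of every compact subset of `Ω`. -/
def MemLpLocOn {n : ℕ} {F : Type*} [NormedAddCommGroup F] (p : ℝ)
    (Ω : Set (EuclideanSpace ℝ (Fin n))) (f : EuclideanSpace ℝ (Fin n) → F) : Prop :=
  ∀ C : Set (EuclideanSpace ℝ (Fin n)), IsCompact C → C ⊆ Ω →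
    MemLp f (ENNReal.ofReal p) (volume.restrict C)

/-- `G` is the weak (distributional) gradient of `h` in `Ω`:
`∫ h ∂_v φ = - ∫ ⟨G, v⟩ φ` for all test functions `φ` and all directions `v`. -/
def HasWeakGradientOn {n : ℕ} (Ω : Set (EuclideanSpace ℝ (Fin n)))
    (h : EuclideanSpace ℝ (Fin n) → ℝ)
    (G : EuclideanSpace ℝ (Fin n) → EuclideanSpace ℝ (Fin n)) : Prop :=
  ∀ φ : EuclideanSpace ℝ (Fin n) → ℝ, IsTestFunctionOn Ω φ →
    ∀ v : EuclideanSpace ℝ (Fin n),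
      ∫ x in Ω, h x * fderiv ℝ φ x v = - ∫ x in Ω, inner ℝ (G x) v * φ x

/-- `h` is `p`-harmonic in the open set `Ω`: it is continuous, lies in `W^{1,p}_loc(Ω)` (with weak
gradient `G`), and `∫ |∇h|^{p-2} ⟨∇h, ∇φ⟩ = 0` for all `φ ∈ C₀^∞(Ω)`. -/
def IsPHarmonicOn {n : ℕ} (p : ℝ) (Ω : Set (EuclideanSpace ℝ (Fin n)))
    (h : EuclideanSpace ℝ (Fin n) → ℝ) : Prop :=
  ContinuousOn h Ω ∧ MemLpLocOn p Ω h ∧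
    ∃ G : EuclideanSpace ℝ (Fin n) → EuclideanSpace ℝ (Fin n),
      MemLpLocOn p Ω G ∧ HasWeakGradientOn Ω h G ∧
      ∀ φ : EuclideanSpace ℝ (Fin n) → ℝ, IsTestFunctionOn Ω φ →
        ∫ x in Ω, ‖G x‖ ^ (p - 2) * inner ℝ (G x) (gradient φ x) = 0

/-- `u : Ω → (-∞, ∞]` is `p`-superharmonic in the open set `Ω`. The sets `D ⊂⊂ Ω` are the open
sets whose closure is compact and contained in `Ω`. -/
structure IsPSuperharmonicOn {n : ℕ} (p : ℝ) (Ω : Set (EuclideanSpace ℝ (Fin n)))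
    (u : EuclideanSpace ℝ (Fin n) → EReal) : Prop where
  ne_bot : ∀ x ∈ Ω, u x ≠ ⊥
  exists_ne_top : ∃ x ∈ Ω, u x ≠ ⊤
  lowerSemicontinuousOn : LowerSemicontinuousOn u Ω
  comparison : ∀ D : Set (EuclideanSpace ℝ (Fin n)), IsOpen D → IsCompact (closure D) →
    closure D ⊆ Ω → ∀ h : EuclideanSpace ℝ (Fin n) → ℝ, ContinuousOn h (closure D) →
      IsPHarmonicOn p D h → (∀ x ∈ frontier D, (h x : EReal) ≤ u x) →
        ∀ x ∈ D, (h x : EReal) ≤ u x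

open Classical in
/-- `-ln |x - y|` as an element of `(-∞, ∞]`, with the value `∞` at the pole `x = y`. -/
noncomputable def negLogDist {n : ℕ} (x y : EuclideanSpace ℝ (Fin n)) : EReal :=
  if x = y then ⊤ else ((-Real.log ‖x - y‖ : ℝ) : EReal)

end PLaplace

/-! The `n`-Laplacian is nonlinear for `n > 2`, so `n`-superharmonicity does not pass to sums in
general, and the logarithms cannot simply be added. The substitute is the dominative condition `Δw +
(n - 2) D²w(u, u) ≤ 0` for every unit `u` (`IsDominative`). For fixed `u` it is linear in `w`, so it
survives sums and nonnegative multiples; with `u` along `∇w` it gives `div(|∇w|^{n-2} ∇w) ≤ 0`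
(`IsDominative.isSmoothSupersolution`). Smooth concave functions satisfy it, and so does `-½ ln(|x -
y|² + τ)`, by Cauchy-Schwarz.

On a fixed ball, absolute convergence at `x₀` bounds the `i`-th term below by `-c i` with `∑ c i`
finite. After this shift, the sums of the first `N` terms regularised with `τ = 1/(N+1)` increase to
the series (`exists_dominative_approx`). This yields convergence in `(-∞, ∞]` and lower
semicontinuity.

For the comparison property, compactness of the frontier replaces the supremum by a single
approximant at the cost of `ε`, and `K` is replaced by a mollification. It remains to compare an
`n`-harmonic `h` with a smooth supersolution `w` (`IsSmoothSupersolution.comparison`). Smooth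
truncations of `h_k - w - 2ε`, with `h_k` mollifications of `h`, serve as test functions. In the
limit, strict monotonicity of `ξ ↦ |ξ|^{p-2} ξ` kills the gradient of the truncation, so the
truncation itself vanishes. -/

namespace PLaplace

open Filter Topology ContinuousLinearMap Convolution

/-! ### Mollification in `L^p`. -/

section Mollification

variable {G F : Type*} [NormedAddCommGroup G] [NormedSpace ℝ G] [FiniteDimensional ℝ G]
  [MeasurableSpace G] [BorelSpace G] {μ : Measure G} [μ.IsAddHaarMeasure]
  [NormedAddCommGroup F] [NormedSpace ℝ F]

/-- Mollification does not increase the `L^p` norm. -/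
theorem eLpNorm_normed_convolution_le (φ : ContDiffBump (0 : G)) {f : G → F}
    (hf : AEStronglyMeasurable f μ) {p : ℝ} (hp : 1 ≤ p) :
    eLpNorm (φ.normed μ ⋆[lsmul ℝ ℝ, μ] f) (ENNReal.ofReal p) μ
      ≤ eLpNorm f (ENNReal.ofReal p) μ := by
  have hp0 : 0 < p := by linarith
  have hpe0 : ENNReal.ofReal p ≠ 0 := by simpa using hp0
  obtain ⟨g, hg, hfg⟩ := hf
  rw [eLpNorm_congr_ae hfg,
    convolution_congr (lsmul ℝ ℝ) (Filter.EventuallyEq.rfl) hfg]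
  set ρ : G → ENNReal := fun t => ENNReal.ofReal (φ.normed μ t) with hρ
  have hρm : Measurable ρ := φ.continuous_normed.measurable.ennreal_ofReal
  set ν := μ.withDensity ρ with hν
  have : IsProbabilityMeasure ν := by
    constructor
    rw [hν, withDensity_apply _ MeasurableSet.univ, Measure.restrict_univ, hρ,
      ← ofReal_integral_eq_lintegral_ofReal φ.integrable_normed
        (Eventually.of_forall φ.nonneg_normed), φ.integral_normed, ENNReal.ofReal_one]
  -- Jensen's inequality: the mollification is a mean of translates of `g` against the probability
  -- measure `ν`, where the `L^1` norm is at most the `L^p` norm.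
  have key : ∀ x, ‖(φ.normed μ ⋆[lsmul ℝ ℝ, μ] g) x‖ₑ ^ p
      ≤ ∫⁻ t, ρ t * ‖g (x - t)‖ₑ ^ p ∂μ := by
    intro x
    have hgx : StronglyMeasurable fun t => g (x - t) :=
      hg.comp_measurable (measurable_const.sub measurable_id)
    have h1 : ‖(φ.normed μ ⋆[lsmul ℝ ℝ, μ] g) x‖ₑ ≤ eLpNorm (fun t => g (x - t)) 1 ν := by
      rw [eLpNorm_one_eq_lintegral_enorm, hν,
        lintegral_withDensity_eq_lintegral_mul _ hρm hgx.enorm]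
      refine (enorm_integral_le_lintegral_enorm _).trans (lintegral_mono fun t => ?_)
      simp only [lsmul_apply, enorm_smul, Pi.mul_apply, hρ]
      rw [Real.enorm_of_nonneg (φ.nonneg_normed t)]
    have h2 := h1.trans (eLpNorm_le_eLpNorm_of_exponent_le (p := 1) (q := ENNReal.ofReal p)
      (by simpa using hp) hgx.aestronglyMeasurable)
    rw [eLpNorm_eq_lintegral_rpow_enorm_toReal hpe0 ENNReal.ofReal_ne_top,
      ENNReal.toReal_ofReal hp0.le, hν,
      lintegral_withDensity_eq_lintegral_mul _ hρm (hgx.enorm.pow_const p)] at h2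
    calc _ ≤ _ := ENNReal.rpow_le_rpow h2 hp0.le
      _ = _ := by
        rw [← ENNReal.rpow_mul, one_div_mul_cancel hp0.ne', ENNReal.rpow_one]
        rfl
  rw [eLpNorm_eq_lintegral_rpow_enorm_toReal hpe0 ENNReal.ofReal_ne_top,
    eLpNorm_eq_lintegral_rpow_enorm_toReal hpe0 ENNReal.ofReal_ne_top,
    ENNReal.toReal_ofReal hp0.le]
  refine ENNReal.rpow_le_rpow ?_ (by positivity)
  calc ∫⁻ x, ‖(φ.normed μ ⋆[lsmul ℝ ℝ, μ] g) x‖ₑ ^ p ∂μ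
      ≤ ∫⁻ x, ∫⁻ t, ρ t * ‖g (x - t)‖ₑ ^ p ∂μ ∂μ := lintegral_mono key
    _ = ∫⁻ t, ∫⁻ x, ρ t * ‖g (x - t)‖ₑ ^ p ∂μ ∂μ := by
        refine lintegral_lintegral_swap (Measurable.aemeasurable ?_)
        exact (hρm.comp measurable_snd).mul
          ((hg.comp_measurable (measurable_fst.sub measurable_snd)).enorm.pow_const p)
    _ = ∫⁻ t, ρ t * ∫⁻ x, ‖g x‖ₑ ^ p ∂μ ∂μ := by
        refine lintegral_congr fun t => ?_
        rw [lintegral_const_mul _ (by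
          exact (hg.comp_measurable (measurable_id.sub_const t)).enorm.pow_const p),
          lintegral_sub_right_eq_self (fun x => ‖g x‖ₑ ^ p) t]
    _ = ∫⁻ x, ‖g x‖ₑ ^ p ∂μ := by
        rw [lintegral_mul_const _ hρm]
        have : ∫⁻ t, ρ t ∂μ = 1 := by
          rw [← setLIntegral_univ, ← withDensity_apply _ MeasurableSet.univ]
          exact measure_univ (μ := ν)
        rw [this, one_mul]

theorem convolutionExists_normed (φ : ContDiffBump (0 : G)) {f : G → F}
    (hf : LocallyIntegrable f μ) : ConvolutionExists (φ.normed μ) f (lsmul ℝ ℝ) μ :=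
  φ.hasCompactSupport_normed.convolutionExists_left (lsmul ℝ ℝ) φ.continuous_normed hf

/-- Mollifications of a continuous compactly supported function converge in `L^p`. -/
theorem tendsto_eLpNorm_normed_convolution_sub_of_continuous [CompleteSpace F]
    {φ : ℕ → ContDiffBump (0 : G)}
    (hφ : Tendsto (fun k => (φ k).rOut) atTop (𝓝 0)) {g : G → F} (hg : Continuous g)
    (hgc : HasCompactSupport g) (p : ENNReal) :
    Tendsto (fun k => eLpNorm (((φ k).normed μ ⋆[lsmul ℝ ℝ, μ] g) - g) p μ) atTop (𝓝 0) := by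
  set S := Metric.cthickening 1 (tsupport g) with hS
  have hSc : IsCompact S := hgc.isCompact.cthickening
  have hμ : μ S ^ p.toReal⁻¹ ≠ ⊤ :=
    ENNReal.rpow_ne_top_of_nonneg (by positivity) hSc.measure_lt_top.ne
  have huc := hgc.uniformContinuous_of_continuous hg
  rw [ENNReal.tendsto_atTop_zero]
  intro ε hε
  -- The difference will be at most `η` and supported in `S`, so its norm is at most `μ S ^ (1/p) *
  -- η`.
  obtain ⟨η, hη0, hη⟩ : ∃ η : ℝ, 0 < η ∧ μ S ^ p.toReal⁻¹ * ENNReal.ofReal η ≤ ε := by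
    have : Tendsto (fun η : ℝ => μ S ^ p.toReal⁻¹ * ENNReal.ofReal η) (𝓝[>] 0) (𝓝 0) := by
      have h1 : Tendsto (fun η : ℝ => ENNReal.ofReal η) (𝓝[>] 0) (𝓝 0) := by
        have := (ENNReal.continuous_ofReal.tendsto 0).mono_left (nhdsWithin_le_nhds (s := Set.Ioi 0))
        simpa using this
      simpa using ENNReal.Tendsto.const_mul h1 (Or.inr hμ)
    have h2 := (this.eventually (ge_mem_nhds hε)).and self_mem_nhdsWithin
    obtain ⟨η, h3, h4⟩ := h2.exists
    exact ⟨η, h4, h3⟩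
  obtain ⟨δ, hδ, hδη⟩ := Metric.uniformContinuous_iff.1 huc η hη0
  have hev : ∀ᶠ k in atTop, (φ k).rOut < min δ 1 := hφ.eventually (gt_mem_nhds (by positivity))
  obtain ⟨N, hN⟩ := eventually_atTop.1 hev
  refine ⟨N, fun k hk => ?_⟩
  have hk := hN k hk
  have hsupp : Function.support (((φ k).normed μ ⋆[lsmul ℝ ℝ, μ] g) - g) ⊆ S := by
    intro x hx
    by_contra hxS
    apply hx
    have hz : ∀ z ∈ Metric.ball x (φ k).rOut, g z = g x := by
      intro z hz
      have hz1 : z ∉ tsupport g := fun h => hxS <|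
        Metric.mem_cthickening_of_dist_le x z 1 _ h (by
          rw [dist_comm]; exact (Metric.mem_ball.1 hz).le.trans (hk.le.trans (min_le_right _ _)))
      have hx1 : x ∉ tsupport g := fun h => hxS (Metric.self_subset_cthickening _ h)
      rw [image_eq_zero_of_notMem_tsupport hz1, image_eq_zero_of_notMem_tsupport hx1]
    rw [Pi.sub_apply, (φ k).normed_convolution_eq_right hz, sub_self]
  rw [← eLpNorm_restrict_eq_of_support_subset hsupp]
  refine (eLpNorm_le_of_ae_bound (C := η) (Eventually.of_forall fun x => ?_)).trans ?_
  · rw [Pi.sub_apply, ← dist_eq_norm]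
    refine (φ k).dist_normed_convolution_le hg.aestronglyMeasurable fun z hz => (hδη ?_).le
    exact (Metric.mem_ball.1 hz).trans (hk.trans_le (min_le_left _ _))
  · rwa [Measure.restrict_apply MeasurableSet.univ, Set.univ_inter]

/-- Mollifications of an `L^p` function converge in `L^p`. -/
theorem tendsto_eLpNorm_normed_convolution_sub [CompleteSpace F]
    {φ : ℕ → ContDiffBump (0 : G)}
    (hφ : Tendsto (fun k => (φ k).rOut) atTop (𝓝 0)) {p : ℝ} (hp : 1 ≤ p) {f : G → F}
    (hf : MemLp f (ENNReal.ofReal p) μ) :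
    Tendsto (fun k => eLpNorm (((φ k).normed μ ⋆[lsmul ℝ ℝ, μ] f) - f) (ENNReal.ofReal p) μ)
      atTop (𝓝 0) := by
  have hp1 : 1 ≤ ENNReal.ofReal p := by simpa using hp
  rw [ENNReal.tendsto_atTop_zero]
  intro ε hε
  have hε3 : ε / 3 ≠ 0 := by simpa using hε.ne'
  obtain ⟨g, hgc, hfg, hg, hgp⟩ :=
    hf.exists_hasCompactSupport_eLpNorm_sub_le ENNReal.ofReal_ne_top hε3
  obtain ⟨N, hN⟩ := ENNReal.tendsto_atTop_zero.1
    (tendsto_eLpNorm_normed_convolution_sub_of_continuous (μ := μ) hφ hg hgc (ENNReal.ofReal p))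
    (ε / 3) (pos_iff_ne_zero.2 hε3)
  refine ⟨N, fun k hk => ?_⟩
  have hfl := hf.locallyIntegrable hp1
  have hgl := hgp.locallyIntegrable hp1
  have hcont : ∀ u : G → F, LocallyIntegrable u μ →
      Continuous ((φ k).normed μ ⋆[lsmul ℝ ℝ, μ] u) := fun u hu =>
    (φ k).hasCompactSupport_normed.continuous_convolution_left (lsmul ℝ ℝ)
      (φ k).continuous_normed hu
  -- The `ε/3` argument: the first summand is small by contractivity, the second by the continuous
  -- case, the third by density.
  have hdec : ((φ k).normed μ ⋆[lsmul ℝ ℝ, μ] f) - f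
      = ((φ k).normed μ ⋆[lsmul ℝ ℝ, μ] (f - g))
        + ((((φ k).normed μ ⋆[lsmul ℝ ℝ, μ] g) - g) + (g - f)) := by
    have : (φ k).normed μ ⋆[lsmul ℝ ℝ, μ] f
        = ((φ k).normed μ ⋆[lsmul ℝ ℝ, μ] (f - g)) + ((φ k).normed μ ⋆[lsmul ℝ ℝ, μ] g) := by
      rw [← (convolutionExists_normed (φ k) (hfl.sub hgl)).distrib_add
        (convolutionExists_normed (φ k) hgl), sub_add_cancel]
    rw [this]; abel
  have hfgm : AEStronglyMeasurable (f - g) μ := (hf.sub hgp).aestronglyMeasurable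
  rw [hdec]
  refine (eLpNorm_add_le (hcont _ (hfl.sub hgl)).aestronglyMeasurable
    (((hcont _ hgl).sub hg).aestronglyMeasurable.add (hgp.sub hf).aestronglyMeasurable) hp1).trans ?_
  refine (add_le_add ((eLpNorm_normed_convolution_le (φ k) hfgm hp).trans hfg)
    (eLpNorm_add_le ((hcont _ hgl).sub hg).aestronglyMeasurable
      (hgp.sub hf).aestronglyMeasurable hp1)).trans ?_
  rw [eLpNorm_sub_comm g f]
  refine (add_le_add le_rfl (add_le_add (hN k hk) hfg)).trans ?_
  rw [← add_assoc, ENNReal.add_thirds]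

end Mollification

/-! ### Monotonicity and integrability of the flux. -/

/-- The vector field `ξ ↦ |ξ|^{p-2} ξ` of the `p`-Laplace operator. -/
noncomputable def flux {V : Type*} [NormedAddCommGroup V] [NormedSpace ℝ V] (p : ℝ) (ξ : V) : V :=
  ‖ξ‖ ^ (p - 2) • ξ

theorem rpow_sub_rpow_mul_sq_sub_sq_nonneg {q s t : ℝ} (hq : 0 ≤ q) (hs : 0 ≤ s) (ht : 0 ≤ t) :
    0 ≤ (s ^ q - t ^ q) * (s ^ 2 - t ^ 2) := by
  rcases le_total s t with h | h
  · exact mul_nonneg_of_nonpos_of_nonpos (sub_nonpos.2 (Real.rpow_le_rpow hs h hq))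
      (sub_nonpos.2 (by gcongr))
  · exact mul_nonneg (sub_nonneg.2 (Real.rpow_le_rpow ht h hq)) (sub_nonneg.2 (by gcongr))

section Flux

variable {V : Type*} [NormedAddCommGroup V] [InnerProductSpace ℝ V]

theorem inner_flux (p : ℝ) (ξ ζ : V) : inner ℝ (flux p ξ) ζ = ‖ξ‖ ^ (p - 2) * inner ℝ ξ ζ := by
  rw [flux, real_inner_smul_left]

/-- This splitting makes monotonicity visible: for `p ≥ 2` the last term is nonnegative because both
powers increase with the norm, and the first is positive unless `ξ = ζ`. -/
theorem inner_flux_sub_flux_eq (p : ℝ) (ξ ζ : V) :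
    inner ℝ (flux p ξ - flux p ζ) (ξ - ζ) =
      (‖ξ‖ ^ (p - 2) + ‖ζ‖ ^ (p - 2)) / 2 * ‖ξ - ζ‖ ^ 2
        + (‖ξ‖ ^ (p - 2) - ‖ζ‖ ^ (p - 2)) * (‖ξ‖ ^ 2 - ‖ζ‖ ^ 2) / 2 := by
  rw [inner_sub_left, inner_flux, inner_flux, inner_sub_right, inner_sub_right,
    real_inner_self_eq_norm_sq, real_inner_self_eq_norm_sq, real_inner_comm ξ ζ,
    norm_sub_sq_real]
  ring

theorem inner_flux_sub_flux_nonneg {p : ℝ} (hp : 2 ≤ p) (ξ ζ : V) :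
    0 ≤ inner ℝ (flux p ξ - flux p ζ) (ξ - ζ) := by
  rw [inner_flux_sub_flux_eq]
  have := rpow_sub_rpow_mul_sq_sub_sq_nonneg (sub_nonneg.2 hp) (norm_nonneg ξ) (norm_nonneg ζ)
  positivity

/-- Strict monotonicity of the flux. -/
theorem eq_of_inner_flux_sub_flux_eq_zero {p : ℝ} (hp : 2 ≤ p) {ξ ζ : V}
    (h : inner ℝ (flux p ξ - flux p ζ) (ξ - ζ) = 0) : ξ = ζ := by
  by_contra hne
  have h1 : 0 < ‖ξ - ζ‖ := norm_pos_iff.2 (sub_ne_zero.2 hne)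
  have h2 : 0 < ‖ξ‖ ^ (p - 2) + ‖ζ‖ ^ (p - 2) := by
    by_cases hξ : ξ = 0
    · have : ζ ≠ 0 := fun hζ => hne (hξ.trans hζ.symm)
      have := Real.rpow_pos_of_pos (norm_pos_iff.2 this) (p - 2)
      positivity
    · have := Real.rpow_pos_of_pos (norm_pos_iff.2 hξ) (p - 2)
      positivity
  rw [inner_flux_sub_flux_eq] at h
  have h3 := rpow_sub_rpow_mul_sq_sub_sq_nonneg (sub_nonneg.2 hp) (norm_nonneg ξ) (norm_nonneg ζ)
  have h4 : 0 < (‖ξ‖ ^ (p - 2) + ‖ζ‖ ^ (p - 2)) / 2 * ‖ξ - ζ‖ ^ 2 := by positivity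
  linarith

theorem norm_flux {p : ℝ} (hp : 2 ≤ p) (ξ : V) : ‖flux p ξ‖ = ‖ξ‖ ^ (p - 1) := by
  rw [flux, norm_smul, Real.norm_of_nonneg (by positivity)]
  rcases eq_or_ne ξ 0 with rfl | hξ
  · rw [norm_zero, mul_zero, Real.zero_rpow (by linarith)]
  · nth_rewrite 2 [← Real.rpow_one ‖ξ‖]
    rw [← Real.rpow_add (norm_pos_iff.2 hξ)]
    ring_nf

/-- The flux has norm `‖G‖ ^ (p - 1)`, and the conjugate exponent is `p / (p - 1)`; hence it pairs
with `L^p` gradients by Hölder. -/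
theorem memLp_flux {α : Type*} [MeasurableSpace α] {μ : Measure α} {p : ℝ} (hp : 2 ≤ p)
    {G : α → V} (hG : MemLp G (ENNReal.ofReal p) μ) :
    MemLp (fun x => flux p (G x)) (ENNReal.ofReal (p.conjExponent)) μ := by
  have h := hG.norm_rpow_div (ENNReal.ofReal (p - 1))
  rw [ENNReal.toReal_ofReal (by linarith), ← ENNReal.ofReal_div_of_pos (by linarith)] at h
  refine h.of_le ?_ (Eventually.of_forall fun x => ?_)
  · exact (hG.1.norm.aemeasurable.pow_const _).aestronglyMeasurable.smul hG.1
  · rw [norm_flux hp, Real.norm_of_nonneg (by positivity)]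

end Flux

/-! ### Limits of weighted pairings and gradients of mollifications. -/

/-- Passage to the limit in `∫ θ_k ⟨B, G_k - W⟩` when `G_k → G` in `L^p`, `B` lies in the dual space
and the weights `θ_k` converge boundedly. -/
theorem tendsto_integral_weighted_inner {V α : Type*} [NormedAddCommGroup V]
    [InnerProductSpace ℝ V] [MeasurableSpace α] {μ : Measure α} {p : ℝ} (hp : 2 ≤ p)
    {B G W : α → V} {g : ℕ → α → V} {θ : ℕ → α → ℝ} {θ' : α → ℝ} {M : ℝ}
    (hB : MemLp B (ENNReal.ofReal p.conjExponent) μ) (hG : MemLp G (ENNReal.ofReal p) μ)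
    (hW : MemLp W (ENNReal.ofReal p) μ) (hg : ∀ k, AEStronglyMeasurable (g k) μ)
    (hgG : Tendsto (fun k => eLpNorm (g k - G) (ENNReal.ofReal p) μ) atTop (𝓝 0))
    (hθ : ∀ k, AEStronglyMeasurable (θ k) μ) (hM : ∀ k x, |θ k x| ≤ M)
    (hθ' : ∀ x, Tendsto (fun k => θ k x) atTop (𝓝 (θ' x))) :
    Tendsto (fun k => ∫ x, inner ℝ (B x) (θ k x • (g k x - W x)) ∂μ) atTop
      (𝓝 (∫ x, inner ℝ (B x) (θ' x • (G x - W x)) ∂μ)) := by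
  have hpq : p.HolderConjugate p.conjExponent := Real.HolderConjugate.conjExponent (by linarith)
  have hH : ENNReal.HolderTriple (ENNReal.ofReal p.conjExponent) (ENNReal.ofReal p) 1 :=
    hpq.symm.ennrealOfReal
  -- The sign of `M` is available only at a point, since `α` may be empty.
  have hM0 : ∀ x : α, 0 ≤ M := fun x => (abs_nonneg _).trans (hM 0 x)
  have hbase : Integrable (fun x => inner ℝ (B x) (G x - W x)) μ := by
    rw [← memLp_one_iff_integrable]
    refine MemLp.of_bilin (fun a b => inner ℝ a b) 1 hB (hG.sub hW)
      (hB.1.inner (hG.1.sub hW.1)) (Eventually.of_forall fun x => ?_)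
    rw [one_mul]
    exact nnnorm_inner_le_nnnorm _ _
  have hI1 : ∀ k, Integrable (fun x => θ k x * inner ℝ (B x) (G x - W x)) μ := fun k =>
    hbase.bdd_mul (c := M) (hθ k) (Eventually.of_forall fun x => hM k x)
  -- Write `g k - W = (g k - G) + (G - W)`. Hölder sends the first part to zero; dominated
  -- convergence treats the second.
  have hbd : ∀ k, eLpNorm (fun x => θ k x * inner ℝ (B x) (g k x - G x)) 1 μ
      ≤ M.toNNReal * eLpNorm B (ENNReal.ofReal p.conjExponent) μ
        * eLpNorm (g k - G) (ENNReal.ofReal p) μ := by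
    intro k
    have h1 : eLpNorm (fun x => θ k x * inner ℝ (B x) (g k x - G x)) 1 μ
        ≤ eLpNorm (fun x => (M * ‖B x‖) * ‖(g k - G) x‖) 1 μ := by
      refine eLpNorm_mono_real fun x => ?_
      rw [norm_mul, mul_assoc]
      exact mul_le_mul (hM k x) (norm_inner_le_norm _ _) (norm_nonneg _) (hM0 x)
    refine h1.trans (eLpNorm_le_eLpNorm_mul_eLpNorm_of_nnnorm hB.1 ((hg k).sub hG.1)
      (fun a b => M * ‖a‖ * ‖b‖) M.toNNReal (Eventually.of_forall fun x => ?_))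
    rw [← NNReal.coe_le_coe]
    push_cast
    rw [Real.coe_toNNReal _ (hM0 x), norm_mul, norm_mul, norm_norm, norm_norm,
      Real.norm_of_nonneg (hM0 x)]
  have hlim : Tendsto (fun k => eLpNorm (fun x => θ k x * inner ℝ (B x) (g k x - G x)) 1 μ)
      atTop (𝓝 0) := by
    refine tendsto_of_tendsto_of_tendsto_of_le_of_le tendsto_const_nhds ?_ (fun _ => zero_le)
      hbd
    have := ENNReal.Tendsto.const_mul hgG (a := M.toNNReal *
      eLpNorm B (ENNReal.ofReal p.conjExponent) μ)
      (Or.inr (ENNReal.mul_ne_top ENNReal.coe_ne_top hB.2.ne))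
    simpa using this
  have hfin : ∀ᶠ k in atTop,
      Integrable (fun x => θ k x * inner ℝ (B x) (g k x - G x)) μ := by
    filter_upwards [hlim.eventually (gt_mem_nhds ENNReal.zero_lt_top)] with k hk
    rw [← memLp_one_iff_integrable]
    exact ⟨(hθ k).mul (hB.1.inner ((hg k).sub hG.1)), hk⟩
  have hL2 : Tendsto (fun k => ∫ x, θ k x * inner ℝ (B x) (g k x - G x) ∂μ) atTop (𝓝 0) := by
    have := tendsto_integral_of_L1' (μ := μ) (fun _ : α => (0 : ℝ)) aestronglyMeasurable_const hfin
      (hlim.congr fun k => by congr 1; funext x; simp)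
    simpa using this
  have hL1 : Tendsto (fun k => ∫ x, θ k x * inner ℝ (B x) (G x - W x) ∂μ) atTop
      (𝓝 (∫ x, θ' x * inner ℝ (B x) (G x - W x) ∂μ)) := by
    refine tendsto_integral_of_dominated_convergence
      (fun x => M * ‖inner ℝ (B x) (G x - W x)‖) (fun k => (hI1 k).1) (hbase.norm.const_mul M)
      (fun k => Eventually.of_forall fun x => ?_) (Eventually.of_forall fun x => ?_)
    · rw [norm_mul]
      exact mul_le_mul_of_nonneg_right (hM k x) (norm_nonneg _)
    · exact (hθ' x).mul_const _
  have hsum := hL1.add hL2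
  rw [add_zero] at hsum
  have e1 : ∫ x, inner ℝ (B x) (θ' x • (G x - W x)) ∂μ
      = ∫ x, θ' x * inner ℝ (B x) (G x - W x) ∂μ := by
    simp_rw [real_inner_smul_right]
  rw [e1]
  refine hsum.congr' ?_
  filter_upwards [hfin] with k hk
  rw [← integral_add (hI1 k) hk]
  refine integral_congr_ae (Eventually.of_forall fun x => ?_)
  simp only [real_inner_smul_right, ← mul_add, ← inner_add_right]
  congr 2
  abel

/-- The gradient of a mollification is the mollification of the weak gradient. -/
theorem fderiv_normed_convolution_eq_inner {n : ℕ} {D S : Set (EuclideanSpace ℝ (Fin n))}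
    {h h' : EuclideanSpace ℝ (Fin n) → ℝ} {G G' : EuclideanSpace ℝ (Fin n) → EuclideanSpace ℝ (Fin n)}
    (hG : HasWeakGradientOn D h G) (hSD : S ⊆ D) (hh' : LocallyIntegrable h')
    (hG' : LocallyIntegrable G') (hhS : ∀ x ∈ S, h' x = h x) (hGS : ∀ x ∈ S, G' x = G x)
    (φ : ContDiffBump (0 : EuclideanSpace ℝ (Fin n))) {x : EuclideanSpace ℝ (Fin n)}
    (hx : Metric.closedBall x φ.rOut ⊆ S) (v : EuclideanSpace ℝ (Fin n)) :
    fderiv ℝ (φ.normed volume ⋆[lsmul ℝ ℝ, volume] h') x v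
      = inner ℝ ((φ.normed volume ⋆[lsmul ℝ ℝ, volume] G') x) v := by
  set ρ := φ.normed (volume : Measure (EuclideanSpace ℝ (Fin n))) with hρ
  have hρs : ContDiff ℝ ∞ ρ := φ.contDiff_normed
  have hρc : HasCompactSupport ρ := φ.hasCompactSupport_normed
  have hρd : Differentiable ℝ ρ := hρs.differentiable (by simp)
  -- The weak gradient is tested with the reflected kernel centred at `x`, supported in `S`, where
  -- `h'` and `G'` agree with `h` and `G`. The sign from the reflection cancels the one in the
  -- definition of the weak gradient.
  set ψ : EuclideanSpace ℝ (Fin n) → ℝ := fun t => ρ (x - t) with hψ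
  have hψd : ∀ t, fderiv ℝ ψ t v = - fderiv ℝ ρ (x - t) v := by
    intro t
    have h1 : HasFDerivAt (fun t => x - t) (-(ContinuousLinearMap.id ℝ _)) t := by
      simpa using (hasFDerivAt_id t).const_sub x
    have := ((hρd (x - t)).hasFDerivAt.comp t h1).fderiv
    rw [hψ]
    change fderiv ℝ (ρ ∘ fun t => x - t) t v = _
    rw [this]
    simp
  have hψsupp : tsupport ψ ⊆ Metric.closedBall x φ.rOut := by
    refine closure_minimal (fun t ht => ?_) Metric.isClosed_closedBall
    have : x - t ∈ Function.support ρ := ht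
    rw [hρ, φ.support_normed_eq, Metric.mem_ball, dist_zero_right] at this
    rw [Metric.mem_closedBall, dist_comm, dist_eq_norm]
    exact this.le
  have hψc : HasCompactSupport ψ :=
    HasCompactSupport.of_support_subset_isCompact (isCompact_closedBall x φ.rOut)
      (subset_closure.trans hψsupp)
  have hψt : IsTestFunctionOn D ψ :=
    ⟨hρs.comp (contDiff_const.sub contDiff_id), hψc, hψsupp.trans (hx.trans hSD)⟩
  have hw := hG ψ hψt v
  have hoff : ∀ t, t ∉ S → ψ t = 0 := fun t ht =>
    image_eq_zero_of_notMem_tsupport fun h => ht (hx (hψsupp h))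
  have hoff' : ∀ t, t ∉ S → fderiv ℝ ψ t = 0 := fun t ht =>
    image_eq_zero_of_notMem_tsupport fun h =>
      ht (hx (hψsupp (tsupport_fderiv_subset ℝ h)))
  have e1 : ∫ t in D, h t * fderiv ℝ ψ t v = ∫ t, h' t * fderiv ℝ ψ t v := by
    rw [setIntegral_eq_integral_of_forall_compl_eq_zero fun t ht => by
      rw [hoff' t fun h => ht (hSD h)]; simp]
    refine integral_congr_ae (Eventually.of_forall fun t => ?_)
    by_cases ht : t ∈ S
    · simp only [hhS t ht]
    · simp [hoff' t ht]
  have e2 : ∫ t in D, inner ℝ (G t) v * ψ t = ∫ t, inner ℝ (G' t) v * ψ t := by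
    rw [setIntegral_eq_integral_of_forall_compl_eq_zero fun t ht => by
      rw [hoff t fun h => ht (hSD h)]; simp]
    refine integral_congr_ae (Eventually.of_forall fun t => ?_)
    by_cases ht : t ∈ S
    · simp only [hGS t ht]
    · simp [hoff t ht]
  rw [e1, e2] at hw
  rw [(hρc.hasFDerivAt_convolution_left (lsmul ℝ ℝ) (hρs.of_le (by simp)) hh' x).fderiv,
    convolution_eq_swap]
  have hint : Integrable (fun t => ((lsmul ℝ ℝ).precompL (EuclideanSpace ℝ (Fin n))
      (fderiv ℝ ρ (x - t))) (h' t)) := by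
    have := (hρc.fderiv ℝ).convolutionExists_left
      ((lsmul ℝ ℝ : ℝ →L[ℝ] ℝ →L[ℝ] ℝ).precompL (EuclideanSpace ℝ (Fin n)))
      (hρs.continuous_fderiv (by simp)) hh' x
    exact this.integrable_swap
  rw [ContinuousLinearMap.integral_apply hint]
  have hintG : Integrable (fun t => ρ (x - t) • G' t) :=
    (convolutionExists_normed φ hG' x).integrable_swap
  rw [convolution_eq_swap, real_inner_comm]
  have e3 : inner ℝ v (∫ t, (lsmul ℝ ℝ) (ρ (x - t)) (G' t)) = ∫ t, inner ℝ (G' t) v * ψ t := by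
    simp only [lsmul_apply]
    rw [← integral_inner hintG]
    refine integral_congr_ae (Eventually.of_forall fun t => ?_)
    simp only [real_inner_smul_right, hψ]
    rw [real_inner_comm, mul_comm]
  rw [e3, ← neg_eq_iff_eq_neg.2 hw, ← integral_neg]
  refine integral_congr_ae (Eventually.of_forall fun t => ?_)
  simp only [hψd, precompL_apply, lsmul_apply, smul_eq_mul]
  ring

/-! ### Cutoffs and truncated test functions. -/

section EuclideanSpace

variable {n : ℕ}

local notation "𝔼" => EuclideanSpace ℝ (Fin n)

theorem continuous_gradient {V : Type*} [NormedAddCommGroup V] [InnerProductSpace ℝ V]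
    [CompleteSpace V] {f : V → ℝ} (hf : ContDiff ℝ ∞ f) : Continuous (gradient f) :=
  (InnerProductSpace.toDual ℝ V).symm.continuous.comp (hf.continuous_fderiv (by simp))

/-- The derivative is continuous and vanishes outside `[0, 1]`. The bound controls the weights in
the gradients of the truncations. -/
theorem exists_abs_deriv_smoothTransition_le :
    ∃ M : ℝ, ∀ t, |deriv Real.smoothTransition t| ≤ M := by
  have hc : Continuous (deriv Real.smoothTransition) :=
    (Real.smoothTransition.contDiff (n := ⊤)).continuous_deriv (by simp)
  have hs : HasCompactSupport (deriv Real.smoothTransition) := by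
    refine HasCompactSupport.intro (isCompact_Icc (a := (0 : ℝ)) (b := 1)) fun t ht => ?_
    rw [Set.mem_Icc, not_and_or, not_le, not_le] at ht
    rcases ht with ht | ht
    · have : Real.smoothTransition =ᶠ[𝓝 t] fun _ => 0 := by
        filter_upwards [gt_mem_nhds ht] with s hs using Real.smoothTransition.zero_of_nonpos hs.le
      rw [this.deriv_eq, deriv_const]
    · have : Real.smoothTransition =ᶠ[𝓝 t] fun _ => 1 := by
        filter_upwards [lt_mem_nhds ht] with s hs using Real.smoothTransition.one_of_one_le hs.le
      rw [this.deriv_eq, deriv_const]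
  obtain ⟨M, hM⟩ := hs.exists_bound_of_continuous hc
  exact ⟨M, hM⟩

/-- A smooth cutoff function for a compact set, supported in a prescribed thickening. -/
theorem exists_smooth_cutoff {C : Set 𝔼} (hC : IsCompact C) {r : ℝ} (hr : 0 < r) :
    ∃ χ : 𝔼 → ℝ, ContDiff ℝ ∞ χ ∧ (∀ x, 0 ≤ χ x) ∧ (∀ x, χ x ≤ 1) ∧ (∀ x ∈ C, χ x = 1) ∧
      tsupport χ ⊆ Metric.cthickening r C := by
  obtain ⟨χ, h1, h2, h3, h4⟩ := exists_contMDiff_support_eq_eq_one_iff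
    (modelWithCornersSelf ℝ 𝔼) (n := ⊤) (Metric.isOpen_thickening (δ := r) (E := C)) hC.isClosed
    (Metric.self_subset_thickening hr C)
  refine ⟨χ, h1.contDiff, fun x => (h2 ⟨x, rfl⟩).1, fun x => (h2 ⟨x, rfl⟩).2,
    fun x hx => (h4 x).1 hx, ?_⟩
  rw [tsupport, h3]
  exact Metric.closure_thickening_subset_cthickening _ _

/-- A continuous function on an open set agrees on a given compact subset with a continuous
compactly supported function. -/
theorem exists_continuous_hasCompactSupport_eqOn {D C : Set 𝔼} (hD : IsOpen D) (hC : IsCompact C)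
    (hCD : C ⊆ D) {h : 𝔼 → ℝ} (hh : ContinuousOn h D) :
    ∃ h' : 𝔼 → ℝ, Continuous h' ∧ HasCompactSupport h' ∧ ∀ x ∈ C, h' x = h x := by
  obtain ⟨r, hr, hrD⟩ := hC.exists_cthickening_subset_open hD hCD
  obtain ⟨χ, h1, h2, h3, h4, h5⟩ := exists_smooth_cutoff hC hr
  have hs : tsupport (fun x => χ x * h x) ⊆ Metric.cthickening r C :=
    (tsupport_mul_subset_left (f := χ) (g := h)).trans h5
  refine ⟨fun x => χ x * h x, ?_, ?_, fun x hx => by simp [h4 x hx]⟩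
  · exact (h1.continuous.continuousOn.mul hh).continuous_of_tsupport_subset hD (hs.trans hrD)
  · exact HasCompactSupport.of_support_subset_isCompact hC.cthickening (subset_closure.trans hs)

/-- The truncated test functions `χ F(f)` have gradient `χ F'(f) ∇f` when `f ≤ 0` off the set where
`χ = 1`. -/
theorem fderiv_cutoff_mul_smoothTransition {χ f : 𝔼 → ℝ} (hχ : ContDiff ℝ ∞ χ)
    (hχ1 : ∀ x, χ x ≤ 1) (hf : ContDiff ℝ ∞ f) {x : 𝔼}
    (hfx : x ∈ tsupport χ → 0 < f x → χ x = 1) (v : 𝔼) :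
    fderiv ℝ (fun x => χ x * Real.smoothTransition (f x)) x v
      = χ x * deriv Real.smoothTransition (f x) * fderiv ℝ f x v := by
  have hχd := (hχ.differentiable (by simp) x).hasFDerivAt
  have hfd := (hf.differentiable (by simp) x).hasFDerivAt
  have hF : HasDerivAt Real.smoothTransition (deriv Real.smoothTransition (f x)) (f x) :=
    ((Real.smoothTransition.contDiff (n := ⊤)).differentiable (by simp) _).hasDerivAt
  have hd := hχd.mul (hF.comp_hasFDerivAt x hfd)
  -- The term with `∇χ` disappears: where `f ≤ 0` the transition vanishes, and where `χ = 1` the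
  -- cutoff is at its maximum.
  have hz : Real.smoothTransition (f x) • fderiv ℝ χ x = 0 := by
    by_cases hx : x ∈ tsupport χ
    · rcases le_or_gt (f x) 0 with h0 | h0
      · rw [Real.smoothTransition.zero_of_nonpos h0, zero_smul]
      · have hmax : IsLocalMax χ x := Eventually.of_forall fun y => by
          rw [hfx hx h0]; exact hχ1 y
        rw [hmax.fderiv_eq_zero, smul_zero]
    · rw [image_eq_zero_of_notMem_tsupport fun h => hx (tsupport_fderiv_subset ℝ h), smul_zero]
  have := hd.fderiv
  change fderiv ℝ (fun x => χ x * Real.smoothTransition (f x)) x = _ at this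
  rw [this]
  have hz' := congrArg (fun L : 𝔼 →L[ℝ] ℝ => L v) hz
  simp only [smul_apply, smul_eq_mul, zero_apply] at hz'
  simp only [add_apply, smul_apply, smul_eq_mul, Function.comp_apply, hz', add_zero]
  ring

/-- Integration by parts against a coordinate: the mean of a test function in terms of its
gradient. -/
theorem integral_eq_neg_integral_coord_mul_fderiv {φ : 𝔼 → ℝ} (hφ : ContDiff ℝ ∞ φ)
    (hφc : HasCompactSupport φ) {e : 𝔼} (he : ‖e‖ = 1) :
    ∫ x, φ x = - ∫ x, inner ℝ e x * fderiv ℝ φ x e := by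
  have hcf : Continuous fun x => fderiv ℝ φ x e :=
    (hφ.continuous_fderiv (by simp)).clm_apply continuous_const
  have hcs : HasCompactSupport fun x => fderiv ℝ φ x e := hφc.fderiv_apply ℝ e
  have hd : ∀ x : 𝔼, HasFDerivAt (fun x : 𝔼 => inner ℝ e x) (innerSL ℝ e) x := fun x =>
    (innerSL ℝ e).hasFDerivAt
  have hfd : ∀ x, fderiv ℝ (fun x : 𝔼 => inner ℝ e x) x e = 1 := fun x => by
    rw [(hd x).fderiv, innerSL_apply_apply, real_inner_self_eq_norm_sq, he, one_pow]
  have hc : Continuous fun x : 𝔼 => inner ℝ e x := (innerSL ℝ e).continuous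
  have := integral_mul_fderiv_eq_neg_fderiv_mul_of_integrable (𝕜 := ℝ)
    (μ := (volume : Measure 𝔼)) (f := fun x : 𝔼 => inner ℝ e x)
    (g := φ) (v := e)
    (by simpa only [hfd, one_mul] using hφ.continuous.integrable_of_hasCompactSupport hφc)
    ((hc.mul hcf).integrable_of_hasCompactSupport hcs.mul_left)
    ((hc.mul hφ.continuous).integrable_of_hasCompactSupport hφc.mul_left)
    (fun x _ => (hd x).differentiableAt) (fun x _ => hφ.differentiable (by simp) x)
  rw [this, neg_neg]
  simp only [hfd, one_mul]

theorem memLp_restrict_of_continuous {V : Type*} [NormedAddCommGroup V] {g : 𝔼 → V}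
    (hg : Continuous g) {C : Set 𝔼} (hC : IsCompact C) (q : ENNReal) :
    MemLp g q (volume.restrict C) := by
  have : IsFiniteMeasure (volume.restrict C) := ⟨by simpa using hC.measure_lt_top⟩
  obtain ⟨M, hM⟩ := hC.exists_bound_of_continuousOn hg.continuousOn
  exact MemLp.of_bound (hg.continuousOn.aestronglyMeasurable_of_isCompact hC hC.measurableSet) M
    ((ae_restrict_iff' hC.measurableSet).2 (Eventually.of_forall hM))

/-! ### Comparison with smooth supersolutions. -/

/-- The smooth function `w` is a weak supersolution of the `p`-Laplace equation in the whole
space. -/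
def IsSmoothSupersolution (p : ℝ) (w : 𝔼 → ℝ) : Prop :=
  ContDiff ℝ ∞ w ∧ ∀ φ : 𝔼 → ℝ, IsTestFunctionOn Set.univ φ → (∀ x, 0 ≤ φ x) →
    0 ≤ ∫ x, inner ℝ (flux p (gradient w x)) (gradient φ x)

/-- If the truncated test functions have gradients `θ_k (g_k - ∇w)` with `g_k → ∇h` in `L^p`, then
`∇h = ∇w` where the limit weight is positive. -/
theorem ae_weight_smul_sub_eq_zero {p : ℝ} (hp : 2 ≤ p) {w : 𝔼 → ℝ}
    {C : Set 𝔼} {G : 𝔼 → 𝔼} {g : ℕ → 𝔼 → 𝔼} {θ : ℕ → 𝔼 → ℝ}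
    {θ' : 𝔼 → ℝ} {M : ℝ} (hG : MemLp G (ENNReal.ofReal p) (volume.restrict C))
    (hW : MemLp (gradient w) (ENNReal.ofReal p) (volume.restrict C))
    (hg : ∀ k, AEStronglyMeasurable (g k) (volume.restrict C))
    (hgG : Tendsto (fun k => eLpNorm (g k - G) (ENNReal.ofReal p) (volume.restrict C))
      atTop (𝓝 0))
    (hθ : ∀ k, Continuous (θ k)) (hM : ∀ k x, |θ k x| ≤ M)
    (hθ' : ∀ x, Tendsto (fun k => θ k x) atTop (𝓝 (θ' x))) (hθ0 : ∀ x, 0 ≤ θ' x)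
    (hθc : Continuous θ')
    (h1 : ∀ᶠ k in atTop, ∫ x in C, inner ℝ (flux p (G x)) (θ k x • (g k x - gradient w x)) = 0)
    (h2 : ∀ᶠ k in atTop,
      0 ≤ ∫ x in C, inner ℝ (flux p (gradient w x)) (θ k x • (g k x - gradient w x))) :
    ∀ᵐ x ∂(volume.restrict C), θ' x • (G x - gradient w x) = 0 := by
  have hpq : p.HolderConjugate p.conjExponent := Real.HolderConjugate.conjExponent (by linarith)
  have hH : ENNReal.HolderTriple (ENNReal.ofReal p.conjExponent) (ENNReal.ofReal p) 1 :=
    hpq.symm.ennrealOfReal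
  have hθm : ∀ k, AEStronglyMeasurable (θ k) (volume.restrict C) := fun k =>
    (hθ k).aestronglyMeasurable
  have hfG := memLp_flux hp hG
  have hfW := memLp_flux hp hW
  have l1 := tendsto_integral_weighted_inner hp hfG hG hW hg hgG hθm hM hθ'
  have l2 := tendsto_integral_weighted_inner hp hfW hG hW hg hgG hθm hM hθ'
  have e1 : ∫ x in C, inner ℝ (flux p (G x)) (θ' x • (G x - gradient w x)) = 0 :=
    tendsto_nhds_unique l1 (tendsto_const_nhds.congr' (h1.mono fun k hk => hk.symm))
  have e2 : 0 ≤ ∫ x in C, inner ℝ (flux p (gradient w x)) (θ' x • (G x - gradient w x)) :=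
    ge_of_tendsto l2 h2
  have hbound : ∀ x, |θ' x| ≤ M := fun x =>
    le_of_tendsto ((hθ' x).abs) (Eventually.of_forall fun k => hM k x)
  have hint : ∀ B : 𝔼 → 𝔼, MemLp B (ENNReal.ofReal p.conjExponent) (volume.restrict C) →
      Integrable (fun x => inner ℝ (B x) (θ' x • (G x - gradient w x))) (volume.restrict C) := by
    intro B hB
    simp_rw [real_inner_smul_right]
    refine Integrable.bdd_mul (c := M) ?_ hθc.aestronglyMeasurable (Eventually.of_forall hbound)
    rw [← memLp_one_iff_integrable]
    refine MemLp.of_bilin (fun a b => inner ℝ a b) 1 hB (hG.sub hW)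
      (hB.1.inner (hG.1.sub hW.1)) (Eventually.of_forall fun x => ?_)
    rw [one_mul]
    exact nnnorm_inner_le_nnnorm _ _
  -- Subtracting the two limits gives a nonpositive integral with nonnegative integrand, which
  -- therefore vanishes almost everywhere.
  have e3 : ∫ x in C, θ' x * inner ℝ (flux p (G x) - flux p (gradient w x)) (G x - gradient w x)
      = 0 - ∫ x in C, inner ℝ (flux p (gradient w x)) (θ' x • (G x - gradient w x)) := by
    rw [← e1, ← integral_sub (hint _ hfG) (hint _ hfW)]
    refine integral_congr_ae (Eventually.of_forall fun x => ?_)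
    simp only [real_inner_smul_right, inner_sub_left]
    ring
  have hnn : ∀ x, 0 ≤ θ' x *
      inner ℝ (flux p (G x) - flux p (gradient w x)) (G x - gradient w x) := fun x =>
    mul_nonneg (hθ0 x) (inner_flux_sub_flux_nonneg hp _ _)
  have hI : Integrable (fun x => θ' x *
      inner ℝ (flux p (G x) - flux p (gradient w x)) (G x - gradient w x))
      (volume.restrict C) := by
    refine ((hint _ hfG).sub (hint _ hfW)).congr (Eventually.of_forall fun x => ?_)
    simp only [Pi.sub_apply, real_inner_smul_right, inner_sub_left]
    ring
  have e4 : ∫ x in C,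
      θ' x * inner ℝ (flux p (G x) - flux p (gradient w x)) (G x - gradient w x) = 0 :=
    le_antisymm (by rw [e3]; linarith) (integral_nonneg hnn)
  rw [integral_eq_zero_iff_of_nonneg hnn hI] at e4
  filter_upwards [e4] with x hx
  rcases mul_eq_zero.1 hx with h | h
  · rw [h, zero_smul]
  · rw [eq_of_inner_flux_sub_flux_eq_zero hp h, sub_self, smul_zero]

/-- Comparison principle: a weakly `p`-harmonic function lies below a smooth supersolution if it
does so on the boundary. -/
theorem IsSmoothSupersolution.comparison {p : ℝ} (hp : 2 ≤ p) (hn : 0 < n) {w h : 𝔼 → ℝ}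
    (hw : IsSmoothSupersolution p w) {D : Set 𝔼} (hD : IsOpen D) (hDc : IsCompact (closure D))
    (hhc : ContinuousOn h (closure D)) (hh : IsPHarmonicOn p D h)
    (hb : ∀ x ∈ frontier D, h x ≤ w x) : ∀ x ∈ D, h x ≤ w x := by
  obtain ⟨hws, hwt⟩ := hw
  obtain ⟨hhD, -, G, hGp, hGw, hGt⟩ := hh
  have hwc := hws.continuous
  suffices H : ∀ ε : ℝ, 0 < ε → ∀ x ∈ D, h x ≤ w x + 2 * ε by
    intro x hx
    refine le_of_forall_pos_le_add fun ε hε => ?_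
    have := H (ε / 2) (by positivity) x hx
    linarith
  intro ε hε
  -- This set avoids the frontier, where `h ≤ w`, so it is a compact subset of `D` and leaves room
  -- for cutoffs and mollification.
  set C₀ : Set 𝔼 := closure D ∩ (fun x => h x - w x) ⁻¹' Set.Ici ε with hC₀
  have hC₀c : IsCompact C₀ := hDc.of_isClosed_subset
    ((hhc.sub hwc.continuousOn).preimage_isClosed_of_isClosed isClosed_closure isClosed_Ici)
    Set.inter_subset_left
  have hC₀D : C₀ ⊆ D := by
    rintro x ⟨hx1, hx2⟩
    by_contra hxD
    have : x ∈ frontier D := ⟨hx1, by rwa [hD.interior_eq]⟩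
    have h1 := hb x this
    have h2 : ε ≤ h x - w x := hx2
    linarith
  obtain ⟨R, hR, hRD⟩ := hC₀c.exists_cthickening_subset_open hD hC₀D
  -- Half of the room is for the support of `χ`, the other half for the mollification radius.
  set r := R / 2 with hr
  have hr0 : 0 < r := by positivity
  set C₁ := Metric.cthickening R C₀ with hC₁
  set C₂ := Metric.cthickening r C₀ with hC₂
  have hC₁c : IsCompact C₁ := hC₀c.cthickening
  have hC₂c : IsCompact C₂ := hC₀c.cthickening
  have hC₂₁ : C₂ ⊆ C₁ := Metric.cthickening_mono (by linarith) _
  have hball : ∀ x ∈ C₂, Metric.closedBall x r ⊆ C₁ := by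
    intro x hx y hy
    have : y ∈ Metric.cthickening r C₂ := Metric.mem_cthickening_of_dist_le y x r _ hx hy
    have h2 := Metric.cthickening_cthickening_subset hr0.le hr0.le C₀ this
    rwa [hr, add_halves] at h2
  obtain ⟨χ, hχs, hχ0, hχ1, hχC, hχsupp⟩ := exists_smooth_cutoff hC₀c hr0
  obtain ⟨h', hh'c, hh's, hh'e⟩ := exists_continuous_hasCompactSupport_eqOn hD hC₁c hRD hhD
  set G' := C₁.indicator G with hG'
  have hp1 : 1 ≤ ENNReal.ofReal p := by simpa using by linarith
  have hG'p : MemLp G' (ENNReal.ofReal p) volume :=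
    (memLp_indicator_iff_restrict hC₁c.measurableSet).2 (hGp C₁ hC₁c hRD)
  have hG'e : ∀ x ∈ C₁, G' x = G x := fun x hx => Set.indicator_of_mem hx _
  have hG'l := hG'p.locallyIntegrable hp1
  have hh'l : LocallyIntegrable h' := hh'c.locallyIntegrable
  let b : ℕ → ContDiffBump (0 : 𝔼) := fun k =>
    ⟨r / (k + 1) / 2, r / (k + 1), by positivity, half_lt_self (by positivity)⟩
  have hbr : ∀ k, (b k).rOut = r / ((k : ℝ) + 1) := fun k => rfl
  have hb0 : Tendsto (fun k => (b k).rOut) atTop (𝓝 0) := by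
    simp_rw [hbr, div_eq_mul_one_div r]
    simpa using (tendsto_one_div_add_atTop_nhds_zero_nat (𝕜 := ℝ)).const_mul r
  have hbr' : ∀ k, (b k).rOut ≤ r := fun k => by
    rw [hbr]; exact div_le_self hr0.le (by linarith [k.cast_nonneg (α := ℝ)])
  set g : ℕ → 𝔼 → 𝔼 := fun k => (b k).normed volume ⋆[lsmul ℝ ℝ, volume] G' with hg
  set H : ℕ → 𝔼 → ℝ := fun k => (b k).normed volume ⋆[lsmul ℝ ℝ, volume] h' with hH
  have hHs : ∀ k, ContDiff ℝ ∞ (H k) := fun k =>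
    (b k).hasCompactSupport_normed.contDiff_convolution_left (n := ⊤) (lsmul ℝ ℝ)
      (b k).contDiff_normed hh'l
  have hgc : ∀ k, Continuous (g k) := fun k =>
    (b k).hasCompactSupport_normed.continuous_convolution_left (lsmul ℝ ℝ)
      (b k).continuous_normed hG'l
  have hHlim : ∀ x, Tendsto (fun k => H k x) atTop (𝓝 (h' x)) := fun x =>
    ContDiffBump.convolution_tendsto_right_of_continuous hb0 hh'c x
  have hHu : ∀ᶠ k in atTop, ∀ x, |H k x - h' x| < ε := by
    obtain ⟨δ, hδ, hδη⟩ := Metric.uniformContinuous_iff.1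
      (hh's.uniformContinuous_of_continuous hh'c) (ε / 2) (by positivity)
    filter_upwards [hb0.eventually (gt_mem_nhds hδ)] with k hk x
    rw [← Real.dist_eq]
    refine ((b k).dist_normed_convolution_le (ε := ε / 2) hh'c.aestronglyMeasurable
      fun z hz => (hδη ?_).le).trans_lt (half_lt_self hε)
    exact (Metric.mem_ball.1 hz).trans hk
  -- One `ε` absorbs the mollification error, the other forces `h - w ≥ ε`; so on `C₂`, for large
  -- `k`, `f k > 0` implies `x ∈ C₀`, where `χ = 1`.
  set f : ℕ → 𝔼 → ℝ := fun k x => H k x - w x - 2 * ε with hf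
  have hfs : ∀ k, ContDiff ℝ ∞ (f k) := fun k => ((hHs k).sub hws).sub contDiff_const
  set φ : ℕ → 𝔼 → ℝ := fun k x => χ x * Real.smoothTransition (f k x) with hφ
  set θ : ℕ → 𝔼 → ℝ := fun k x => χ x * deriv Real.smoothTransition (f k x) with hθ
  set f' : 𝔼 → ℝ := fun x => h' x - w x - 2 * ε with hf'
  set θ' : 𝔼 → ℝ := fun x => χ x * deriv Real.smoothTransition (f' x) with hθ'
  have hflim : ∀ x, Tendsto (fun k => f k x) atTop (𝓝 (f' x)) := fun x =>
    ((hHlim x).sub_const _).sub_const _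
  have hFs : ContDiff ℝ ∞ Real.smoothTransition := Real.smoothTransition.contDiff (n := ⊤)
  have hF'c : Continuous (deriv Real.smoothTransition) := hFs.continuous_deriv (by simp)
  have hφs : ∀ k, ContDiff ℝ ∞ (φ k) := fun k => hχs.mul (hFs.comp (hfs k))
  have hφsupp : ∀ k, tsupport (φ k) ⊆ C₂ := fun k =>
    (tsupport_mul_subset_left (f := χ)
      (g := fun x => Real.smoothTransition (f k x))).trans hχsupp
  have hφc : ∀ k, HasCompactSupport (φ k) := fun k =>
    HasCompactSupport.of_support_subset_isCompact hC₂c (subset_closure.trans (hφsupp k))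
  have hφ0 : ∀ k x, 0 ≤ φ k x := fun k x => mul_nonneg (hχ0 x) (Real.smoothTransition.nonneg _)
  have hφt : ∀ (k) (S : Set 𝔼), C₂ ⊆ S → IsTestFunctionOn S (φ k) := fun k S hS =>
    ⟨hφs k, hφc k, (hφsupp k).trans hS⟩
  have hφgrad : ∀ᶠ k in atTop, ∀ x ∈ C₂,
      gradient (φ k) x = θ k x • (g k x - gradient w x) := by
    filter_upwards [hHu] with k hk x hx
    refine ext_inner_right ℝ fun v => ?_
    have hfd : fderiv ℝ (f k) x v = inner ℝ (g k x - gradient w x) v := by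
      have h1 : HasFDerivAt (f k) (fderiv ℝ (H k) x - fderiv ℝ w x) x :=
        (((hHs k).differentiable (by simp) x).hasFDerivAt.sub
          (hws.differentiable (by simp) x).hasFDerivAt).sub_const _
      rw [h1.fderiv, sub_apply, inner_sub_left, inner_gradient_left,
        fderiv_normed_convolution_eq_inner hGw hRD hh'l hG'l hh'e hG'e (b k)
          ((Metric.closedBall_subset_closedBall (hbr' k)).trans (hball x hx)) v]
    rw [inner_gradient_left, real_inner_smul_left, ← hfd]
    refine fderiv_cutoff_mul_smoothTransition hχs hχ1 (hfs k) (fun _ hpos => ?_) v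
    refine hχC x ⟨subset_closure (hRD (hC₂₁ hx)), ?_⟩
    have h1 := abs_lt.1 (hk x)
    rw [hh'e x (hC₂₁ hx)] at h1
    have h2 : 0 < H k x - w x - 2 * ε := hpos
    change ε ≤ h x - w x
    linarith [h1.2]
  have hgrad0 : ∀ k, ∀ x ∉ C₂, gradient (φ k) x = 0 := fun k x hx => by
    rw [gradient, image_eq_zero_of_notMem_tsupport fun h => hx
      (hφsupp k (tsupport_fderiv_subset ℝ h)), map_zero]
  have hint : ∀ᶠ k in atTop, ∀ (B : 𝔼 → 𝔼) (S : Set 𝔼), C₂ ⊆ S →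
      ∫ x in S, inner ℝ (B x) (gradient (φ k) x)
        = ∫ x in C₂, inner ℝ (B x) (θ k x • (g k x - gradient w x)) := by
    filter_upwards [hφgrad] with k hk B S hS
    rw [setIntegral_eq_integral_of_forall_compl_eq_zero fun x hx => by
        rw [hgrad0 k x fun h => hx (hS h), inner_zero_right],
      ← setIntegral_eq_integral_of_forall_compl_eq_zero (s := C₂) fun x hx => by
        rw [hgrad0 k x hx, inner_zero_right]]
    refine setIntegral_congr_fun hC₂c.measurableSet fun x hx => ?_
    simp only [hk x hx]
  obtain ⟨M, hM⟩ := exists_abs_deriv_smoothTransition_le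
  have hθM : ∀ k x, |θ k x| ≤ M := fun k x => by
    rw [hθ, abs_mul, abs_of_nonneg (hχ0 x)]
    exact (mul_le_of_le_one_left (abs_nonneg _) (hχ1 x)).trans (hM _)
  have hθlim : ∀ x, Tendsto (fun k => θ k x) atTop (𝓝 (θ' x)) := fun x =>
    (((hF'c.tendsto _).comp (hflim x)).const_mul _)
  have hf'c : Continuous f' := (hh'c.sub hwc).sub continuous_const
  have hθc : ∀ k, Continuous (θ k) := fun k =>
    hχs.continuous.mul (hF'c.comp (hfs k).continuous)
  have hG₂ : MemLp G' (ENNReal.ofReal p) (volume.restrict C₂) := hG'p.restrict _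
  have hW₂ := memLp_restrict_of_continuous (continuous_gradient hws) hC₂c (ENNReal.ofReal p)
  have hgG : Tendsto (fun k => eLpNorm (g k - G') (ENNReal.ofReal p) (volume.restrict C₂))
      atTop (𝓝 0) :=
    tendsto_of_tendsto_of_tendsto_of_le_of_le tendsto_const_nhds
      (tendsto_eLpNorm_normed_convolution_sub hb0 (by linarith) hG'p) (fun _ => zero_le)
      (fun k => eLpNorm_mono_measure _ Measure.restrict_le_self)
  -- Each `φ k` is admissible both in the equation for `h` and, being nonnegative, in the inequality
  -- for `w`.
  have hae := ae_weight_smul_sub_eq_zero (θ' := θ') hp hG₂ hW₂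
    (fun k => (hgc k).aestronglyMeasurable) hgG hθc hθM hθlim
    (fun x => mul_nonneg (hχ0 x) (Real.smoothTransition.monotone.deriv_nonneg))
    (hχs.continuous.mul (hF'c.comp hf'c))
    (by
      filter_upwards [hint] with k hk
      have h1 := hGt (φ k) (hφt k D (hC₂₁.trans hRD))
      simp_rw [← inner_flux] at h1
      rw [hk _ D (hC₂₁.trans hRD)] at h1
      rw [← h1]
      refine setIntegral_congr_fun hC₂c.measurableSet fun x hx => ?_
      simp only [hG'e x (hC₂₁ hx)])
    (by
      filter_upwards [hint] with k hk
      have h1 := hwt (φ k) (hφt k _ (Set.subset_univ _)) (hφ0 k)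
      rwa [← setIntegral_univ, hk _ _ (Set.subset_univ _)] at h1)
  set e : 𝔼 := EuclideanSpace.single ⟨0, hn⟩ 1 with he
  have he1 : ‖e‖ = 1 := by simp [he]
  have hcoord : Continuous fun x : 𝔼 => inner ℝ e x • e :=
    (innerSL ℝ e).continuous.smul continuous_const
  -- Pairing with the field `⟨e, x⟩ e` turns the vanishing limit gradient into `∫ φ k → 0`, via
  -- integration by parts against a coordinate. No differentiability of the limit `φ'` is needed.
  have hlimφ := tendsto_integral_weighted_inner hp
    (memLp_restrict_of_continuous hcoord hC₂c (ENNReal.ofReal p.conjExponent)) hG₂ hW₂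
    (fun k => (hgc k).aestronglyMeasurable) hgG (fun k => (hθc k).aestronglyMeasurable) hθM hθlim
  have hz : ∫ x in C₂, inner ℝ (inner ℝ e x • e) (θ' x • (G' x - gradient w x)) = 0 := by
    rw [integral_eq_zero_of_ae]
    filter_upwards [hae] with x hx
    rw [hx, inner_zero_right, Pi.zero_apply]
  rw [hz] at hlimφ
  have hφlim0 : Tendsto (fun k => ∫ x, φ k x) atTop (𝓝 0) := by
    have := hlimφ.neg
    rw [neg_zero] at this
    refine this.congr' ?_
    filter_upwards [hint] with k hk
    rw [integral_eq_neg_integral_coord_mul_fderiv (hφs k) (hφc k) he1,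
      ← hk _ _ (Set.subset_univ _), setIntegral_univ]
    congr 1
    refine integral_congr_ae (Eventually.of_forall fun x => ?_)
    simp only [real_inner_smul_left]
    rw [real_inner_comm (gradient (φ k) x) e, inner_gradient_left]
  set φ' : 𝔼 → ℝ := fun x => χ x * Real.smoothTransition (f' x) with hφ'
  have hχc : HasCompactSupport χ :=
    HasCompactSupport.of_support_subset_isCompact hC₂c (subset_closure.trans hχsupp)
  have hφlim : Tendsto (fun k => ∫ x, φ k x) atTop (𝓝 (∫ x, φ' x)) := by
    refine tendsto_integral_of_dominated_convergence χ
      (fun k => (hφs k).continuous.aestronglyMeasurable)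
      (hχs.continuous.integrable_of_hasCompactSupport hχc)
      (fun k => Eventually.of_forall fun x => ?_) (Eventually.of_forall fun x => ?_)
    · rw [Real.norm_of_nonneg (hφ0 k x)]
      exact mul_le_of_le_one_right (hχ0 x) (Real.smoothTransition.le_one _)
    · exact ((hFs.continuous.tendsto _).comp (hflim x)).const_mul _
  have hφ'0 := tendsto_nhds_unique hφlim hφlim0
  intro x hx
  by_contra! hlt
  have hxC : x ∈ C₀ := ⟨subset_closure hx, by change ε ≤ h x - w x; linarith⟩
  have hpos : 0 < φ' x := by
    simp only [hφ', hχC x hxC, one_mul, hf']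
    refine Real.smoothTransition.pos_of_pos ?_
    rw [hh'e x (Metric.self_subset_cthickening _ hxC)]
    linarith
  have := Continuous.integral_pos_of_hasCompactSupport_nonneg_nonzero
    (μ := (volume : Measure 𝔼)) (hχs.continuous.mul (hFs.continuous.comp hf'c))
    hχc.mul_right (fun x => mul_nonneg (hχ0 x) (Real.smoothTransition.nonneg _)) hpos.ne'
  exact this.ne' hφ'0

/-! ### Dominative superharmonic functions. -/

/-- The second derivative of `w` at `x` as a bilinear form. -/
noncomputable def hess (w : 𝔼 → ℝ) (x u v : 𝔼) : ℝ := fderiv ℝ (fderiv ℝ w) x u v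

/-- The Laplacian of `w` at `x`. -/
noncomputable def lap (w : 𝔼 → ℝ) (x : 𝔼) : ℝ :=
  ∑ i, hess w x (EuclideanSpace.basisFun (Fin n) ℝ i) (EuclideanSpace.basisFun (Fin n) ℝ i)

/-- Smooth functions with `Δw + (n - 2) D²w(u, u) ≤ 0` for every unit vector `u` (dominative
`n`-superharmonic functions). Unlike `n`-superharmonicity this is stable under addition. -/
def IsDominative (w : 𝔼 → ℝ) : Prop :=
  ContDiff ℝ ∞ w ∧ ∀ x u, ‖u‖ ^ 2 * lap w x + ((n : ℝ) - 2) * hess w x u u ≤ 0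

theorem differentiable_fderiv {w : 𝔼 → ℝ} (hw : ContDiff ℝ ∞ w) :
    Differentiable ℝ (fderiv ℝ w) :=
  (hw.fderiv_right (m := ∞) (by simp)).differentiable (by simp)

theorem hess_add {w₁ w₂ : 𝔼 → ℝ} (h₁ : ContDiff ℝ ∞ w₁) (h₂ : ContDiff ℝ ∞ w₂) (x u v : 𝔼) :
    hess (fun x => w₁ x + w₂ x) x u v = hess w₁ x u v + hess w₂ x u v := by
  have e : fderiv ℝ (fun x => w₁ x + w₂ x) = fun x => fderiv ℝ w₁ x + fderiv ℝ w₂ x :=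
    funext fun x => fderiv_fun_add (h₁.differentiable (by simp) x) (h₂.differentiable (by simp) x)
  rw [hess, e, fderiv_fun_add (differentiable_fderiv h₁ x) (differentiable_fderiv h₂ x)]
  rfl

theorem hess_const_mul {w : 𝔼 → ℝ} (h : ContDiff ℝ ∞ w) (c : ℝ) (x u v : 𝔼) :
    hess (fun x => c * w x) x u v = c * hess w x u v := by
  have e : fderiv ℝ (fun x => c * w x) = fun x => c • fderiv ℝ w x :=
    funext fun x => fderiv_const_mul (h.differentiable (by simp) x) c
  rw [hess, e, fderiv_fun_const_smul (differentiable_fderiv h x)]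
  rfl

theorem hess_const (c : ℝ) (x u v : 𝔼) : hess (fun _ : 𝔼 => c) x u v = 0 := by
  have e : fderiv ℝ (fun _ : 𝔼 => c) = fun _ => 0 := funext fun x => fderiv_const_apply c
  rw [hess, e, fderiv_const_apply]
  rfl

theorem IsDominative.add {w₁ w₂ : 𝔼 → ℝ} (h₁ : IsDominative w₁) (h₂ : IsDominative w₂) :
    IsDominative fun x => w₁ x + w₂ x := by
  refine ⟨h₁.1.add h₂.1, fun x u => ?_⟩
  have e1 := h₁.2 x u
  have e2 := h₂.2 x u
  simp only [lap, hess_add h₁.1 h₂.1, Finset.sum_add_distrib] at e1 e2 ⊢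
  linarith

theorem IsDominative.const_mul {w : 𝔼 → ℝ} (h : IsDominative w) {c : ℝ} (hc : 0 ≤ c) :
    IsDominative fun x => c * w x := by
  refine ⟨contDiff_const.mul h.1, fun x u => ?_⟩
  have e1 := mul_nonpos_of_nonneg_of_nonpos hc (h.2 x u)
  simp only [lap, hess_const_mul h.1, ← Finset.mul_sum] at e1 ⊢
  linarith

theorem isDominative_const (c : ℝ) : IsDominative fun _ : 𝔼 => c := by
  refine ⟨contDiff_const, fun x u => ?_⟩
  simp [lap, hess_const]

theorem isDominative_sum {ι : Type*} (s : Finset ι) {w : ι → 𝔼 → ℝ}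
    (h : ∀ i ∈ s, IsDominative (w i)) : IsDominative fun x => ∑ i ∈ s, w i x := by
  classical
  induction s using Finset.induction_on with
  | empty => simpa using isDominative_const (n := n) 0
  | insert i s hi ih =>
    simp only [Finset.sum_insert hi]
    exact (h i (Finset.mem_insert_self _ _)).add
      (ih fun j hj => h j (Finset.mem_insert_of_mem hj))

/-- Summing the condition over an orthonormal basis gives `(2n - 2) Δw ≤ 0`. This controls the extra
term `τ Δw` produced by regularising the flux. -/
theorem IsDominative.lap_nonpos (hn : 2 ≤ n) {w : 𝔼 → ℝ} (h : IsDominative w) (x : 𝔼) :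
    lap w x ≤ 0 := by
  have h1 : ∑ i, (‖EuclideanSpace.basisFun (Fin n) ℝ i‖ ^ 2 * lap w x + ((n : ℝ) - 2) *
      hess w x (EuclideanSpace.basisFun (Fin n) ℝ i) (EuclideanSpace.basisFun (Fin n) ℝ i)) ≤ 0 :=
    Finset.sum_nonpos fun i _ => h.2 x _
  rw [Finset.sum_add_distrib, ← Finset.mul_sum] at h1
  change _ + _ * lap w x ≤ 0 at h1
  simp only [OrthonormalBasis.norm_eq_one, one_pow, one_mul, Finset.sum_const, Finset.card_univ,
    Fintype.card_fin, nsmul_eq_mul] at h1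
  have hn' : (2 : ℝ) ≤ n := by exact_mod_cast hn
  by_contra! h0
  nlinarith

/-- The restriction to the line `x + t u` is concave, so its first derivative is antitone. -/
theorem hess_nonpos_of_concaveOn {w : 𝔼 → ℝ} (hw : ContDiff ℝ ∞ w)
    (hc : ConcaveOn ℝ Set.univ w) (x u : 𝔼) : hess w x u u ≤ 0 := by
  have hl : ∀ t : ℝ, HasDerivAt (fun t : ℝ => x + t • u) u t := fun t => by
    simpa using ((hasDerivAt_id t).smul_const u).const_add x
  have hd : ∀ t : ℝ, HasDerivAt (fun t : ℝ => w (x + t • u)) (fderiv ℝ w (x + t • u) u) t :=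
    fun t => (hw.differentiable (by simp) _).hasFDerivAt.comp_hasDerivAt t (hl t)
  have hcγ : ConcaveOn ℝ Set.univ fun t : ℝ => w (x + t • u) := by
    refine ⟨convex_univ, fun s _ t _ a b ha hb hab => ?_⟩
    have := hc.2 (Set.mem_univ (x + s • u)) (Set.mem_univ (x + t • u)) ha hb hab
    convert this using 2
    have hx : x = (a + b) • x := by rw [hab, one_smul]
    nth_rewrite 1 [hx]
    simp only [smul_eq_mul]
    module
  have hanti : Antitone fun t : ℝ => fderiv ℝ w (x + t • u) u := by
    have := hcγ.antitoneOn_deriv fun t _ => (hd t).differentiableAt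
    rw [antitoneOn_univ] at this
    rwa [funext fun t => (hd t).deriv] at this
  have hd2 : HasDerivAt (fun t : ℝ => fderiv ℝ w (x + t • u) u) (hess w x u u) 0 := by
    have h1 : HasFDerivAt (fderiv ℝ w) (fderiv ℝ (fderiv ℝ w) x) (x + (0 : ℝ) • u) := by
      simpa using (differentiable_fderiv hw x).hasFDerivAt
    have h2 : HasFDerivAt (fun z => fderiv ℝ w z u)
        ((ContinuousLinearMap.apply ℝ ℝ u).comp (fderiv ℝ (fderiv ℝ w) x)) (x + (0 : ℝ) • u) :=
      (ContinuousLinearMap.apply ℝ ℝ u).hasFDerivAt.comp _ h1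
    exact h2.comp_hasDerivAt (0 : ℝ) (hl 0)
  rw [← hd2.deriv]
  exact hanti.deriv_nonpos

theorem isDominative_of_concaveOn (hn : 2 ≤ n) {w : 𝔼 → ℝ} (hw : ContDiff ℝ ∞ w)
    (hc : ConcaveOn ℝ Set.univ w) : IsDominative w := by
  refine ⟨hw, fun x u => ?_⟩
  have hn' : (2 : ℝ) ≤ n := by exact_mod_cast hn
  have h1 : lap w x ≤ 0 := Finset.sum_nonpos fun i _ => hess_nonpos_of_concaveOn hw hc x _
  have h2 := hess_nonpos_of_concaveOn hw hc x u
  have h3 := mul_nonpos_of_nonneg_of_nonpos (sq_nonneg ‖u‖) h1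
  have h4 := mul_nonpos_of_nonneg_of_nonpos (sub_nonneg.2 hn') h2
  linarith

/-! ### Regularised logarithms are dominative. -/

/-- The regularised logarithm `-½ ln(|x - y|² + τ)`. -/
noncomputable def regLog (τ : ℝ) (y x : 𝔼) : ℝ := -(1 / 2) * Real.log (‖x - y‖ ^ 2 + τ)

theorem contDiff_regLog {τ : ℝ} (hτ : 0 < τ) (y : 𝔼) : ContDiff ℝ ∞ (regLog τ y) := by
  refine contDiff_const.mul (ContDiff.log ?_ fun x => by positivity)
  exact ((contDiff_id.sub contDiff_const).norm_sq ℝ).add contDiff_const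

theorem hasFDerivAt_normSq_sub_add (τ : ℝ) (y x : 𝔼) :
    HasFDerivAt (fun x : 𝔼 => ‖x - y‖ ^ 2 + τ) ((2 : ℝ) • innerSL ℝ (x - y)) x := by
  have h := ((hasFDerivAt_id (𝕜 := ℝ) x).sub_const y).norm_sq.add_const τ
  refine h.congr_fderiv ?_
  ext v
  simp [two_smul]

theorem fderiv_regLog {τ : ℝ} (hτ : 0 < τ) (y x : 𝔼) :
    fderiv ℝ (regLog τ y) x = (-(‖x - y‖ ^ 2 + τ)⁻¹) • innerSL ℝ (x - y) := by
  have hs : ‖x - y‖ ^ 2 + τ ≠ 0 := by positivity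
  have h := ((hasFDerivAt_normSq_sub_add τ y x).log hs).const_mul (-(1 / 2))
  change fderiv ℝ (fun x => -(1 / 2) * Real.log (‖x - y‖ ^ 2 + τ)) x = _
  rw [h.fderiv, smul_smul, smul_smul]
  congr 1
  field_simp

theorem hess_regLog {τ : ℝ} (hτ : 0 < τ) (y x u : 𝔼) :
    hess (regLog τ y) x u u = 2 * inner ℝ (x - y) u ^ 2 / (‖x - y‖ ^ 2 + τ) ^ 2
      - ‖u‖ ^ 2 / (‖x - y‖ ^ 2 + τ) := by
  have hs : ‖x - y‖ ^ 2 + τ ≠ 0 := by positivity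
  rw [hess, funext (fderiv_regLog hτ y)]
  have h1 : HasFDerivAt (fun x : 𝔼 => innerSL ℝ (x - y)) (innerSL ℝ) x :=
    (innerSL ℝ (E := 𝔼)).hasFDerivAt.comp x ((hasFDerivAt_id (𝕜 := ℝ) x).sub_const y)
  have h2 := ((hasDerivAt_inv hs).comp_hasFDerivAt x
    (hasFDerivAt_normSq_sub_add τ y x)).neg.smul h1
  have h3 := congrArg (fun L => L u u) h2.fderiv
  have h4 : ∀ z : 𝔼, innerSL ℝ z u = inner ℝ z u := fun z => rfl
  refine h3.trans ?_
  simp only [add_apply, smul_apply, smulRight_apply, neg_apply, Pi.neg_apply, Function.comp_apply,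
    smul_eq_mul, h4]
  rw [real_inner_self_eq_norm_sq]
  field_simp
  ring

/-- With `s = ‖x - y‖² + τ`, Cauchy-Schwarz bounds the expression by `-(2n - 2) τ ‖u‖² / s²`. At `τ
= 0` this bound is zero: the weight `n - 2` is exactly the one that suits the logarithm. -/
theorem isDominative_regLog (hn : 2 ≤ n) {τ : ℝ} (hτ : 0 < τ) (y : 𝔼) :
    IsDominative (regLog τ y) := by
  refine ⟨contDiff_regLog hτ y, fun x u => ?_⟩
  have hn' : (2 : ℝ) ≤ n := by exact_mod_cast hn
  set s := ‖x - y‖ ^ 2 + τ with hs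
  have hs0 : 0 < s := by positivity
  have hlap : lap (regLog τ y) x = 2 * ‖x - y‖ ^ 2 / s ^ 2 - n / s := by
    simp only [lap, hess_regLog hτ, OrthonormalBasis.norm_eq_one]
    rw [Finset.sum_sub_distrib, ← Finset.sum_div, ← Finset.mul_sum,
      OrthonormalBasis.sum_sq_inner_left]
    rw [← hs]
    simp [div_eq_mul_inv]
  rw [hlap, hess_regLog hτ, ← hs]
  have hcs : inner ℝ (x - y) u ^ 2 ≤ ‖x - y‖ ^ 2 * ‖u‖ ^ 2 := by
    rw [← mul_pow, ← sq_abs]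
    exact pow_le_pow_left₀ (abs_nonneg _) (abs_real_inner_le_norm _ _) 2
  have e : ‖u‖ ^ 2 * (2 * ‖x - y‖ ^ 2 / s ^ 2 - n / s) +
      ((n : ℝ) - 2) * (2 * inner ℝ (x - y) u ^ 2 / s ^ 2 - ‖u‖ ^ 2 / s)
      = (‖u‖ ^ 2 * (2 * ‖x - y‖ ^ 2 - n * s) +
      ((n : ℝ) - 2) * (2 * inner ℝ (x - y) u ^ 2 - ‖u‖ ^ 2 * s)) / s ^ 2 := by
    field_simp
  rw [e]
  refine div_nonpos_of_nonpos_of_nonneg ?_ (by positivity)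
  have h1 := mul_le_mul_of_nonneg_left hcs (sub_nonneg.2 hn')
  have h2 : 0 ≤ ‖u‖ ^ 2 * ((2 * n - 2) * τ) := by
    have : (0 : ℝ) ≤ 2 * n - 2 := by linarith
    positivity
  rw [hs]
  nlinarith

/-! ### From the dominative condition to the integral inequality. -/

theorem hess_sum_left (w : 𝔼 → ℝ) (x v : 𝔼) (c : Fin n → ℝ) (b : Fin n → 𝔼) :
    hess w x (∑ i, c i • b i) v = ∑ i, c i * hess w x (b i) v := by
  simp [hess, map_sum]

theorem hess_sum_right (w : 𝔼 → ℝ) (x v : 𝔼) (c : Fin n → ℝ) (b : Fin n → 𝔼) :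
    hess w x v (∑ i, c i • b i) = ∑ i, c i * hess w x v (b i) := by
  simp [hess, map_sum]

theorem hasFDerivAt_fderiv_apply {w : 𝔼 → ℝ} (hw : ContDiff ℝ ∞ w) (x v : 𝔼) :
    HasFDerivAt (fun z => fderiv ℝ w z v)
      ((ContinuousLinearMap.apply ℝ ℝ v).comp (fderiv ℝ (fderiv ℝ w) x)) x :=
  (ContinuousLinearMap.apply ℝ ℝ v).hasFDerivAt.comp x (differentiable_fderiv hw x).hasFDerivAt

theorem contDiff_fderiv_apply {w : 𝔼 → ℝ} (hw : ContDiff ℝ ∞ w) (v : 𝔼) :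
    ContDiff ℝ ∞ fun z => fderiv ℝ w z v :=
  (hw.fderiv_right (m := ∞) (by simp)).clm_apply contDiff_const

theorem gradient_eq_sum (w : 𝔼 → ℝ) (x : 𝔼) :
    gradient w x = ∑ i, fderiv ℝ w x (EuclideanSpace.basisFun (Fin n) ℝ i) •
      EuclideanSpace.basisFun (Fin n) ℝ i := by
  conv_lhs => rw [← (EuclideanSpace.basisFun (Fin n) ℝ).sum_repr (gradient w x)]
  refine Finset.sum_congr rfl fun i _ => ?_
  rw [OrthonormalBasis.repr_apply_apply, real_inner_comm, inner_gradient_left]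

theorem normSq_gradient (w : 𝔼 → ℝ) (x : 𝔼) :
    ‖gradient w x‖ ^ 2 = ∑ i, fderiv ℝ w x (EuclideanSpace.basisFun (Fin n) ℝ i) ^ 2 := by
  rw [← (EuclideanSpace.basisFun (Fin n) ℝ).sum_sq_inner_right]
  simp_rw [real_inner_comm (gradient w x), inner_gradient_left]

/-- The integral inequality for the regularised flux `(|∇w|² + τ)^{(n-2)/2} ∇w`. -/
theorem IsDominative.integral_regularized_nonneg (hn : 2 ≤ n) {w : 𝔼 → ℝ} (hw : IsDominative w)
    {τ : ℝ} (hτ : 0 < τ) {φ : 𝔼 → ℝ} (hφ : ContDiff ℝ ∞ φ) (hφc : HasCompactSupport φ)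
    (hφ0 : ∀ x, 0 ≤ φ x) :
    0 ≤ ∫ x, (‖gradient w x‖ ^ 2 + τ) ^ (((n : ℝ) - 2) / 2) *
      inner ℝ (gradient w x) (gradient φ x) := by
  have hws := hw.1
  set e : Fin n → 𝔼 := fun i => EuclideanSpace.basisFun (Fin n) ℝ i with he
  set d : Fin n → 𝔼 → ℝ := fun i x => fderiv ℝ w x (e i) with hd
  set s : 𝔼 → ℝ := fun x => ∑ i, d i x ^ 2 + τ with hs
  set q : ℝ := ((n : ℝ) - 2) / 2 with hq
  have hss : ∀ x, ‖gradient w x‖ ^ 2 + τ = s x := fun x => by rw [normSq_gradient]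
  have hs0 : ∀ x, 0 < s x := fun x => by rw [← hss]; positivity
  have hdc : ∀ i, ContDiff ℝ ∞ (d i) := fun i => contDiff_fderiv_apply hws (e i)
  have hsc : ContDiff ℝ ∞ s := (ContDiff.sum fun i _ => (hdc i).pow 2).add contDiff_const
  set X : Fin n → 𝔼 → ℝ := fun i x => s x ^ q * d i x with hX
  have hXs : ∀ i, ContDiff ℝ ∞ (X i) := fun i =>
    (hsc.rpow_const_of_ne fun x => (hs0 x).ne').mul (hdc i)
  have hsd : ∀ x v, fderiv ℝ s x v = 2 * hess w x v (gradient w x) := by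
    intro x v
    have h1 : HasFDerivAt s (∑ i, (2 * d i x) •
        ((ContinuousLinearMap.apply ℝ ℝ (e i)).comp (fderiv ℝ (fderiv ℝ w) x))) x := by
      refine (HasFDerivAt.fun_sum fun i _ => ?_).add_const τ
      simpa using (hasFDerivAt_fderiv_apply hws x (e i)).pow 2
    rw [h1.fderiv, gradient_eq_sum, hess_sum_right, Finset.mul_sum]
    simp [hess, sum_apply, mul_assoc, hd, he]
  have hXd : ∀ i x, fderiv ℝ (X i) x (e i) = s x ^ (q - 1) *
      ((n - 2) * (d i x * hess w x (e i) (gradient w x)) + s x * hess w x (e i) (e i)) := by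
    intro i x
    have h1 : HasFDerivAt s (fderiv ℝ s x) x := (hsc.differentiable (by simp) x).hasFDerivAt
    have h2 := (h1.rpow_const (p := q) (Or.inl (hs0 x).ne')).mul
      (hasFDerivAt_fderiv_apply hws x (e i))
    have h3 : s x ^ q = s x ^ (q - 1) * s x := by
      rw [Real.rpow_sub_one (hs0 x).ne', div_mul_cancel₀ _ (hs0 x).ne']
    change fderiv ℝ (fun x => s x ^ q * fderiv ℝ w x (e i)) x (e i) = _
    have h4 := congrArg (fun L : 𝔼 →L[ℝ] ℝ => L (e i)) h2.fderiv
    refine h4.trans ?_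
    have h5 : (n : ℝ) - 2 = 2 * q := by rw [hq]; ring
    simp only [add_apply, smul_apply, smul_eq_mul, hsd, h3, h5, comp_apply, apply_apply]
    change _ * hess w x (e i) (e i) + d i x * _ = _
    ring
  have hdiv : ∀ x, ∑ i, fderiv ℝ (X i) x (e i) ≤ 0 := by
    intro x
    -- The divergence of the regularised flux: the dominative condition with `u = ∇w` handles the
    -- first bracket, and `Δw ≤ 0` the remaining `τ Δw`.
    have e1 : ∑ i, fderiv ℝ (X i) x (e i) = s x ^ (q - 1) *
        ((‖gradient w x‖ ^ 2 * lap w x + ((n : ℝ) - 2) * hess w x (gradient w x) (gradient w x))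
          + τ * lap w x) := by
      simp_rw [hXd]
      rw [← Finset.mul_sum, Finset.sum_add_distrib, ← Finset.mul_sum, ← Finset.mul_sum]
      have e2 : ∑ i, d i x * hess w x (e i) (gradient w x)
          = hess w x (gradient w x) (gradient w x) := by
        rw [← hess_sum_left, ← gradient_eq_sum]
      rw [e2, ← hss]
      change _ * (_ + _ * lap w x) = _
      ring
    rw [e1]
    refine mul_nonpos_of_nonneg_of_nonpos (Real.rpow_nonneg (hs0 x).le _) ?_
    have := mul_nonpos_of_nonneg_of_nonpos hτ.le (hw.lap_nonpos hn x)
    linarith [hw.2 x (gradient w x)]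
  have hφd : ∀ i, Continuous fun x => fderiv ℝ φ x (e i) := fun i =>
    (contDiff_fderiv_apply hφ (e i)).continuous
  have hφdc : ∀ i, HasCompactSupport fun x => fderiv ℝ φ x (e i) := fun i =>
    hφc.fderiv_apply ℝ (e i)
  have hXdc : ∀ i, Continuous fun x => fderiv ℝ (X i) x (e i) := fun i =>
    (contDiff_fderiv_apply (hXs i) (e i)).continuous
  have I1 : ∀ i, Integrable fun x => X i x * fderiv ℝ φ x (e i) := fun i =>
    ((hXs i).continuous.mul (hφd i)).integrable_of_hasCompactSupport (hφdc i).mul_left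
  have I2 : ∀ i, Integrable fun x => fderiv ℝ (X i) x (e i) * φ x := fun i =>
    ((hXdc i).mul hφ.continuous).integrable_of_hasCompactSupport hφc.mul_left
  have key : ∫ x, (‖gradient w x‖ ^ 2 + τ) ^ q * inner ℝ (gradient w x) (gradient φ x)
      = - ∫ x, (∑ i, fderiv ℝ (X i) x (e i)) * φ x := by
    calc _ = ∫ x, ∑ i, X i x * fderiv ℝ φ x (e i) := by
          refine integral_congr_ae (Eventually.of_forall fun x => ?_)
          simp only
          rw [hss, inner_gradient_left, gradient_eq_sum φ, ← inner_gradient_left, inner_sum,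
            Finset.mul_sum]
          refine Finset.sum_congr rfl fun i _ => ?_
          rw [real_inner_smul_right, inner_gradient_left, hX]
          simp only [hd, he]
          ring
      _ = ∑ i, - ∫ x, fderiv ℝ (X i) x (e i) * φ x := by
          rw [integral_finsetSum _ fun i _ => I1 i]
          refine Finset.sum_congr rfl fun i _ => ?_
          exact integral_mul_fderiv_eq_neg_fderiv_mul_of_integrable (I2 i) (I1 i)
            (((hXs i).continuous.mul hφ.continuous).integrable_of_hasCompactSupport hφc.mul_left)
            (fun x _ => (hXs i).differentiable (by simp) x)
            (fun x _ => hφ.differentiable (by simp) x)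
      _ = _ := by
          rw [Finset.sum_neg_distrib, ← integral_finsetSum _ fun i _ => I2 i]
          simp_rw [Finset.sum_mul]
  rw [key, ← integral_neg]
  refine integral_nonneg fun x => ?_
  have := mul_nonpos_of_nonpos_of_nonneg (hdiv x) (hφ0 x)
  simp only [Pi.zero_apply]
  linarith

/-- Dominative superharmonic functions are supersolutions of the `n`-Laplace equation. -/
theorem IsDominative.isSmoothSupersolution (hn : 2 ≤ n) {w : 𝔼 → ℝ} (hw : IsDominative w) :
    IsSmoothSupersolution (n : ℝ) w := by
  refine ⟨hw.1, fun φ hφ hφ0 => ?_⟩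
  have hn' : (2 : ℝ) ≤ n := by exact_mod_cast hn
  have hq : 0 ≤ ((n : ℝ) - 2) / 2 := by linarith
  set q : ℝ := ((n : ℝ) - 2) / 2 with hqd
  have hgw := continuous_gradient hw.1
  have hgφ := continuous_gradient hφ.contDiff
  have hin : Continuous fun x => inner ℝ (gradient w x) (gradient φ x) := hgw.inner hgφ
  have hinc : HasCompactSupport fun x => inner ℝ (gradient w x) (gradient φ x) := by
    refine (hφ.hasCompactSupport.fderiv ℝ).mono fun x hx hx0 => hx ?_
    simp only [gradient, hx0, map_zero, inner_zero_right]
  have hpow : ∀ τ : ℝ, Continuous fun x => (‖gradient w x‖ ^ 2 + τ) ^ q := fun τ =>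
    ((hgw.norm.pow 2).add continuous_const).rpow_const fun x => Or.inr hq
  -- Let `τ = 1/(k+1)` tend to zero; the exponent is nonnegative, so the integrand for `τ = 1`
  -- dominates.
  have hlim : Tendsto (fun k : ℕ => ∫ x, (‖gradient w x‖ ^ 2 + 1 / ((k : ℝ) + 1)) ^ q *
      inner ℝ (gradient w x) (gradient φ x)) atTop
      (𝓝 (∫ x, (‖gradient w x‖ ^ 2 + 0) ^ q * inner ℝ (gradient w x) (gradient φ x))) := by
    refine tendsto_integral_of_dominated_convergence
      (fun x => ‖(‖gradient w x‖ ^ 2 + 1) ^ q * inner ℝ (gradient w x) (gradient φ x)‖)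
      (fun k => ((hpow _).mul hin).aestronglyMeasurable)
      (((hpow 1).mul hin).integrable_of_hasCompactSupport hinc.mul_left).norm
      (fun k => Eventually.of_forall fun x => ?_) (Eventually.of_forall fun x => ?_)
    · rw [norm_mul, norm_mul]
      refine mul_le_mul_of_nonneg_right ?_ (norm_nonneg _)
      rw [Real.norm_of_nonneg (by positivity), Real.norm_of_nonneg (by positivity)]
      have : 1 / ((k : ℝ) + 1) ≤ 1 := by
        rw [div_le_one (by positivity)]; linarith [k.cast_nonneg (α := ℝ)]
      gcongr
    · refine Tendsto.mul_const _ ?_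
      exact ((Real.continuous_rpow_const hq).tendsto _).comp
        (tendsto_one_div_add_atTop_nhds_zero_nat.const_add _)
  have h0 := ge_of_tendsto' hlim fun k =>
    hw.integral_regularized_nonneg hn (by positivity) hφ.contDiff hφ.hasCompactSupport hφ0
  refine h0.trans_eq (integral_congr_ae (Eventually.of_forall fun x => ?_))
  simp only [add_zero]
  rw [inner_flux, ← Real.rpow_natCast, ← Real.rpow_mul (norm_nonneg _), hqd]
  congr 2
  push_cast
  ring

/-! ### Smoothing the concave term. -/

/-- A concave function is approximated uniformly on compact sets by smooth concave functions. -/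
theorem exists_smooth_concaveOn_approx {K : 𝔼 → ℝ} (hK : ConcaveOn ℝ Set.univ K) {S : Set 𝔼}
    (hS : IsCompact S) {ε : ℝ} (hε : 0 < ε) :
    ∃ K' : 𝔼 → ℝ, ContDiff ℝ ∞ K' ∧ ConcaveOn ℝ Set.univ K' ∧ ∀ x ∈ S, |K' x - K x| ≤ ε := by
  have hKc : Continuous K := hK.locallyLipschitz.continuous
  -- The modulus must compare points of `S` with nearby points outside `S` too, since mollification
  -- averages over whole balls.
  obtain ⟨δ, hδ, hδS⟩ := Metric.mem_uniformity_dist.1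
    (hS.uniformContinuousAt_of_continuousAt K (fun a _ => hKc.continuousAt)
      (Metric.dist_mem_uniformity hε))
  let b : ContDiffBump (0 : 𝔼) := ⟨δ / 2, δ, by positivity, half_lt_self hδ⟩
  have hKl := hKc.locallyIntegrable (μ := (volume : Measure 𝔼))
  have hI : ∀ x, Integrable fun t => b.normed volume t * K (x - t) := fun x =>
    convolutionExists_normed b hKl x
  refine ⟨b.normed volume ⋆[lsmul ℝ ℝ, volume] K,
    b.hasCompactSupport_normed.contDiff_convolution_left (n := ⊤) (lsmul ℝ ℝ)
      b.contDiff_normed hKl, ⟨convex_univ, fun x _ z _ s t hs ht hst => ?_⟩, fun x hx => ?_⟩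
  · simp only [convolution_def, lsmul_apply, smul_eq_mul]
    rw [← integral_const_mul, ← integral_const_mul,
      ← integral_add ((hI x).const_mul s) ((hI z).const_mul t)]
    refine integral_mono (((hI x).const_mul s).add ((hI z).const_mul t)) (hI _) fun u => ?_
    have h1 := hK.2 (Set.mem_univ (x - u)) (Set.mem_univ (z - u)) hs ht hst
    have h2 : s • (x - u) + t • (z - u) = s • x + t • z - u := by
      have hu : u = (s + t) • u := by rw [hst, one_smul]
      nth_rewrite 3 [hu]
      module
    rw [h2] at h1
    have h3 := mul_le_mul_of_nonneg_left h1 (b.nonneg_normed (μ := volume) u)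
    simp only [smul_eq_mul] at h3
    simp only
    linarith
  · rw [← Real.dist_eq]
    refine b.dist_normed_convolution_le hKc.aestronglyMeasurable fun z hz => ?_
    rw [dist_comm]
    exact le_of_lt (hδS (by rw [dist_comm]; exact hz) hx)

/-! ### Series with values in `(-∞, ∞]`. -/

theorem hasSum_coe_ereal {ι : Type*} {f : ι → ℝ} {s : ℝ} (h : HasSum f s) :
    HasSum (fun i => (f i : EReal)) (s : EReal) :=
  h.map (⟨⟨Real.toEReal, EReal.coe_zero⟩, EReal.coe_add⟩ : ℝ →+ EReal) continuous_coe_real_ereal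

theorem hasSum_coe_ennreal_ereal {ι : Type*} (f : ι → ENNReal) :
    HasSum (fun i => (f i : EReal)) ((∑' i, f i : ENNReal) : EReal) :=
  ENNReal.summable.hasSum.map
    (⟨⟨ENNReal.toEReal, EReal.coe_ennreal_zero⟩, EReal.coe_ennreal_add⟩ : ENNReal →+ EReal)
    continuous_coe_ennreal_ereal

/-- Addition in `EReal` is discontinuous only at opposite infinities, which a finite second limit
excludes. -/
theorem tendsto_add_coe_ereal {ι : Type*} {l : Filter ι} {f g : ι → EReal} {a : EReal} {r : ℝ}
    (hf : Tendsto f l (𝓝 a)) (hg : Tendsto g l (𝓝 (r : EReal))) :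
    Tendsto (fun i => f i + g i) l (𝓝 (a + r)) :=
  (EReal.continuousAt_add (p := (a, (r : EReal))) (Or.inr (EReal.coe_ne_bot r))
    (Or.inr (EReal.coe_ne_top r))).tendsto.comp (hf.prodMk_nhds hg)

/-- Monotone convergence for series in `(-∞, ∞]` whose terms are, up to a summable shift, increasing
limits of nonnegative reals. -/
theorem hasSum_ereal_of_monotone_approx {f : ℕ → ℕ → ℝ} (hf0 : ∀ N i, 0 ≤ f N i)
    (hmono : ∀ i, Monotone fun N => f N i) {t : ℕ → EReal} {c : ℕ → ℝ} (hc : Summable c)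
    (ht : ∀ i, Tendsto (fun N => (f N i : EReal)) atTop (𝓝 (t i + c i))) :
    HasSum t (⨆ N, ((∑ i ∈ Finset.range N, f N i - ∑' i, c i : ℝ) : EReal)) := by
  set F : ℕ → ENNReal := fun i => ⨆ N, ENNReal.ofReal (f N i) with hF
  have hofm : ∀ i, Monotone fun N => ENNReal.ofReal (f N i) := fun i N M h =>
    ENNReal.ofReal_le_ofReal (hmono i h)
  have hcoe : ∀ r : ℝ, 0 ≤ r → ((ENNReal.ofReal r : ENNReal) : EReal) = (r : EReal) := fun r hr => by
    rw [EReal.coe_ennreal_ofReal, max_eq_left hr]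
  have hFt : ∀ i, (F i : EReal) = t i + c i := fun i => by
    refine tendsto_nhds_unique ?_ (ht i)
    have := (continuous_coe_ennreal_ereal.tendsto _).comp (tendsto_atTop_iSup (hofm i))
    exact this.congr fun N => hcoe _ (hf0 N i)
  set S : ℕ → ℝ := fun N => ∑ i ∈ Finset.range N, f N i with hS
  have hS0 : ∀ N, 0 ≤ S N := fun N => Finset.sum_nonneg fun i _ => hf0 N i
  have hSm : Monotone S := fun N M h =>
    (Finset.sum_le_sum fun i _ => hmono i h).trans
      (Finset.sum_le_sum_of_subset_of_nonneg (Finset.range_mono h) fun i _ _ => hf0 M i)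
  -- The double supremum, over the number of terms and over the approximation index, is attained
  -- along the diagonal.
  have hsum : ∑' i, F i = ⨆ N, ENNReal.ofReal (S N) := by
    rw [ENNReal.tsum_eq_iSup_nat]
    refine le_antisymm (iSup_le fun m => ?_) (iSup_le fun N => ?_)
    · rw [ENNReal.finsetSum_iSup_of_monotone hofm]
      refine iSup_le fun N => ?_
      refine le_trans ?_ (le_iSup _ (max m N))
      rw [ENNReal.ofReal_sum_of_nonneg fun i _ => hf0 _ i]
      exact (Finset.sum_le_sum fun i _ => hofm i (le_max_right m N)).trans
        (Finset.sum_le_sum_of_subset (Finset.range_mono (le_max_left m N)))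
    · refine le_trans ?_ (le_iSup _ N)
      rw [ENNReal.ofReal_sum_of_nonneg fun i _ => hf0 _ i]
      exact Finset.sum_le_sum fun i _ => le_iSup (fun N => ENNReal.ofReal (f N i)) N
  have h1 : HasSum t (((∑' i, F i : ENNReal) : EReal) + ((-∑' i, c i : ℝ) : EReal)) := by
    have h2 := tendsto_add_coe_ereal (hasSum_coe_ennreal_ereal F) (hasSum_coe_ereal hc.hasSum.neg)
    refine h2.congr fun s => ?_
    rw [← Finset.sum_add_distrib]
    refine Finset.sum_congr rfl fun i _ => ?_
    rw [hFt, EReal.coe_neg, ← sub_eq_add_neg, EReal.add_sub_cancel_right]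
  convert h1 using 1
  have h3 : Monotone fun N => ((S N - ∑' i, c i : ℝ) : EReal) := fun N M h =>
    EReal.coe_le_coe_iff.2 (sub_le_sub_right (hSm h) _)
  refine tendsto_nhds_unique (tendsto_atTop_iSup h3) ?_
  have h4 : Tendsto (fun N => ((S N : ℝ) : EReal)) atTop (𝓝 ((∑' i, F i : ENNReal) : EReal)) := by
    rw [hsum]
    refine ((continuous_coe_ennreal_ereal.tendsto _).comp (tendsto_atTop_iSup fun N M h =>
      ENNReal.ofReal_le_ofReal (hSm h))).congr fun N => hcoe _ (hS0 N)
  refine (tendsto_add_coe_ereal h4 tendsto_const_nhds).congr fun N => ?_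
  rw [← EReal.coe_add, sub_eq_add_neg]

theorem regLog_anti {σ τ : ℝ} (hσ : 0 < σ) (h : σ ≤ τ) (y x : 𝔼) :
    regLog τ y x ≤ regLog σ y x := by
  have : Real.log (‖x - y‖ ^ 2 + σ) ≤ Real.log (‖x - y‖ ^ 2 + τ) :=
    Real.log_le_log (by positivity) (by linarith)
  simp only [regLog]
  linarith

/-! ### Approximation of the logarithmic series on balls. -/

/-- The regularised logarithms increase to `-ln |x - y|` as the parameter tends to zero. -/
theorem tendsto_regLog (y x : 𝔼) :
    Tendsto (fun N : ℕ => (regLog (1 / ((N : ℝ) + 1)) y x : EReal)) atTop (𝓝 (negLogDist x y)) := by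
  have hτ := tendsto_one_div_add_atTop_nhds_zero_nat (𝕜 := ℝ)
  by_cases hxy : x = y
  · rw [negLogDist, if_pos hxy]
    have h1 : Tendsto (fun N : ℕ => -Real.log (1 / ((N : ℝ) + 1))) atTop atTop := by
      have : Tendsto (fun N : ℕ => (N : ℝ) + 1) atTop atTop :=
        tendsto_atTop_add_const_right _ _ tendsto_natCast_atTop_atTop
      refine (Real.tendsto_log_atTop.comp this).congr fun N => ?_
      rw [one_div, Real.log_inv, neg_neg, Function.comp_apply]
    have h2 : Tendsto (fun N : ℕ => regLog (1 / ((N : ℝ) + 1)) y x) atTop atTop := by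
      refine (h1.const_mul_atTop (by norm_num : (0 : ℝ) < 1 / 2)).congr fun N => ?_
      simp [regLog, hxy]
    exact EReal.tendsto_coe_nhds_top_iff.2 h2
  · rw [negLogDist, if_neg hxy]
    refine (continuous_coe_real_ereal.tendsto _).comp ?_
    have hpos : 0 < ‖x - y‖ := norm_pos_iff.2 (sub_ne_zero.2 hxy)
    have h1 : Tendsto (fun N : ℕ => ‖x - y‖ ^ 2 + 1 / ((N : ℝ) + 1)) atTop (𝓝 (‖x - y‖ ^ 2)) := by
      simpa using hτ.const_add (‖x - y‖ ^ 2)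
    have h2 := (h1.log (by positivity)).const_mul (-(1 / 2) : ℝ)
    have h3 : -Real.log ‖x - y‖ = -(1 / 2) * Real.log (‖x - y‖ ^ 2) := by
      rw [Real.log_pow]
      push_cast
      ring
    rw [h3]
    exact h2

/-- A lower bound for the regularised logarithms on a ball, in terms of the distance of the pole to
a reference point. -/
theorem neg_log_add_log_le_regLog {R τ : ℝ} (hτ0 : 0 < τ) (hτ1 : τ ≤ 1) {x x₀ y : 𝔼}
    (hx : ‖x‖ ≤ R) (hy : x₀ ≠ y) :
    -(Real.log (R + ‖x₀‖ + 1) + (Real.log 2 + |Real.log ‖x₀ - y‖|)) ≤ regLog τ y x := by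
  have hR : 0 ≤ R := (norm_nonneg x).trans hx
  set d := ‖x₀ - y‖ with hd
  have hd0 : 0 < d := norm_pos_iff.2 (sub_ne_zero.2 hy)
  set M := R + ‖x₀‖ with hM
  have hM0 : 0 ≤ M := by positivity
  have h1 : ‖x - y‖ ≤ M + d := by
    calc ‖x - y‖ = ‖x - x₀ + (x₀ - y)‖ := by rw [sub_add_sub_cancel]
      _ ≤ ‖x - x₀‖ + d := norm_add_le _ _
      _ ≤ ‖x‖ + ‖x₀‖ + d := by gcongr; exact norm_sub_le _ _
      _ ≤ M + d := by rw [hM]; gcongr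
  -- Since `τ ≤ 1`, it is absorbed into `(M + d + 1)²`; the product form separates the ball from the
  -- pole after taking logarithms.
  have h2 : ‖x - y‖ ^ 2 + τ ≤ ((M + 1) * (1 + d)) ^ 2 := by
    have : ‖x - y‖ ^ 2 ≤ (M + d) ^ 2 := by gcongr
    have h3 : M + d + 1 ≤ (M + 1) * (1 + d) := by nlinarith
    have h4 : (M + d + 1) ^ 2 ≤ ((M + 1) * (1 + d)) ^ 2 := by gcongr
    nlinarith
  have h3 : Real.log (‖x - y‖ ^ 2 + τ) ≤ 2 * (Real.log (M + 1) + Real.log (1 + d)) := by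
    refine (Real.log_le_log (by positivity) h2).trans_eq ?_
    rw [Real.log_pow, Real.log_mul (by positivity) (by positivity)]
    norm_num
  have h4 : Real.log (1 + d) ≤ Real.log 2 + |Real.log d| := by
    rcases le_total d 1 with h | h
    · have : Real.log (1 + d) ≤ Real.log 2 := Real.log_le_log (by positivity) (by linarith)
      linarith [abs_nonneg (Real.log d)]
    · have : Real.log (1 + d) ≤ Real.log (2 * d) := Real.log_le_log (by positivity) (by linarith)
      rw [Real.log_mul (by norm_num) hd0.ne'] at this
      linarith [le_abs_self (Real.log d)]
  simp only [regLog]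
  linarith

/-- On every ball the logarithmic series is the increasing limit of dominative functions. -/
theorem exists_dominative_approx (hn : 2 ≤ n) {a : ℕ → ℝ} (ha : ∀ i, 0 ≤ a i) (hA : Summable a)
    {y : ℕ → 𝔼} {x₀ : 𝔼} (hx₀ : ∀ i, 0 < a i → x₀ ≠ y i)
    (hs : Summable fun i => a i * |Real.log ‖x₀ - y i‖|) (R : ℝ) :
    ∃ u : ℕ → 𝔼 → ℝ, (∀ N, IsDominative (u N)) ∧ ∀ x, ‖x‖ ≤ R →
      (Monotone fun N => u N x) ∧
      HasSum (fun i => (a i : EReal) * negLogDist x (y i)) (⨆ N, (u N x : EReal)) := by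
  -- The negated lower bound on the ball, weighted by `a i`; adding it makes all terms nonnegative,
  -- and it is summable by the hypotheses at `x₀`.
  set c : ℕ → ℝ := fun i =>
    a i * (Real.log (R + ‖x₀‖ + 1) + (Real.log 2 + |Real.log ‖x₀ - y i‖|)) with hc
  have hcs : Summable c := by
    have : c = fun i => a i * (Real.log (R + ‖x₀‖ + 1) + Real.log 2)
        + a i * |Real.log ‖x₀ - y i‖| := by
      funext i; simp only [hc]; ring
    rw [this]
    exact (hA.mul_right _).add hs
  set τ : ℕ → ℝ := fun N => 1 / ((N : ℝ) + 1) with hτ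
  have hτ0 : ∀ N, 0 < τ N := fun N => by positivity
  have hτ1 : ∀ N, τ N ≤ 1 := fun N => by
    rw [hτ, div_le_one (by positivity)]; linarith [N.cast_nonneg (α := ℝ)]
  have hτa : Antitone τ := fun N M h => by
    have : (N : ℝ) ≤ M := by exact_mod_cast h
    simp only [hτ]
    gcongr
  set f : 𝔼 → ℕ → ℕ → ℝ := fun x N i => a i * regLog (τ N) (y i) x + c i with hf
  have hf0 : ∀ x, ‖x‖ ≤ R → ∀ N i, 0 ≤ f x N i := by
    intro x hx N i
    -- When `a i = 0` the pole may equal `x₀` and the lower bound is unavailable, but the term is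
    -- zero.
    rcases (ha i).eq_or_lt with h | h
    · simp [hf, hc, ← h]
    · have := mul_le_mul_of_nonneg_left
        (neg_log_add_log_le_regLog (hτ0 N) (hτ1 N) hx (hx₀ i h)) (ha i)
      simp only [hf, hc]
      linarith
  have hfm : ∀ x i, Monotone fun N => f x N i := fun x i N M h =>
    add_le_add_left (mul_le_mul_of_nonneg_left (regLog_anti (hτ0 M) (hτa h) _ _) (ha i)) _
  refine ⟨fun N x => (∑ i ∈ Finset.range N, f x N i) + -∑' i, c i, fun N => ?_,
    fun x hx => ⟨fun N M h => ?_, ?_⟩⟩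
  · exact (isDominative_sum _ fun i _ => ((isDominative_regLog hn (hτ0 N) (y i)).const_mul
      (ha i)).add (isDominative_const (c i))).add (isDominative_const _)
  · exact add_le_add_left ((Finset.sum_le_sum fun i _ => hfm x i h).trans
      (Finset.sum_le_sum_of_subset_of_nonneg (Finset.range_mono h) fun i _ _ => hf0 x hx M i)) _
  · simp_rw [← sub_eq_add_neg]
    refine hasSum_ereal_of_monotone_approx (hf0 x hx) (hfm x) hcs fun i => ?_
    rcases (ha i).eq_or_lt with h | h
    · simp [hf, hc, ← h]
    · have h0 : (a i : EReal) ≠ 0 := by exact_mod_cast h.ne'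
      have h1 : Tendsto (fun N => (a i : EReal) * (regLog (τ N) (y i) x : EReal)) atTop
          (𝓝 ((a i : EReal) * negLogDist x (y i))) :=
        ((EReal.continuousAt_mul (p := ((a i : EReal), negLogDist x (y i)))
          (Or.inl h0) (Or.inl h0)
          (Or.inl (EReal.coe_ne_bot _)) (Or.inl (EReal.coe_ne_top _))).tendsto).comp
          (tendsto_const_nhds.prodMk_nhds (tendsto_regLog (y i) x))
      refine (tendsto_add_coe_ereal h1 (tendsto_const_nhds (x := (c i : EReal)))).congr fun N => ?_
      change _ = ((a i * regLog (τ N) (y i) x + c i : ℝ) : EReal)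
      rw [EReal.coe_add, EReal.coe_mul (a i) (regLog (τ N) (y i) x)]

/-! ### Comparison for the limit function. -/

/-- Comparison principle for functions that are, on a ball, increasing limits of dominative
functions plus a concave function. -/
theorem comparison_of_iSup_dominative (hn : 2 ≤ n) {u : ℕ → 𝔼 → ℝ} (hu : ∀ N, IsDominative (u N))
    {K : 𝔼 → ℝ} (hK : ConcaveOn ℝ Set.univ K) {D : Set 𝔼} (hD : IsOpen D)
    (hDc : IsCompact (closure D)) (hum : ∀ x ∈ closure D, Monotone fun N => u N x) {h : 𝔼 → ℝ}
    (hhc : ContinuousOn h (closure D)) (hh : IsPHarmonicOn (n : ℝ) D h)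
    (hb : ∀ x ∈ frontier D, (h x : EReal) ≤ (⨆ N, (u N x : EReal)) + (K x : EReal)) :
    ∀ x ∈ D, (h x : EReal) ≤ (⨆ N, (u N x : EReal)) + (K x : EReal) := by
  have hKc : Continuous K := hK.locallyLipschitz.continuous
  have hn' : (2 : ℝ) ≤ n := by exact_mod_cast hn
  have hlim : ∀ x ∈ closure D, Tendsto (fun N => ((u N x + K x : ℝ) : EReal)) atTop
      (𝓝 ((⨆ N, (u N x : EReal)) + (K x : EReal))) := by
    intro x hx
    have h1 : Tendsto (fun N => (u N x : EReal)) atTop (𝓝 (⨆ N, (u N x : EReal))) :=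
      tendsto_atTop_iSup fun N M h => EReal.coe_le_coe_iff.2 (hum x hx h)
    exact (tendsto_add_coe_ereal h1 (tendsto_const_nhds (x := (K x : EReal)))).congr fun N => by
      rw [← EReal.coe_add]
  have key : ∀ ε : ℝ, 0 < ε → ∀ x ∈ D,
      ((h x - 3 * ε : ℝ) : EReal) ≤ (⨆ N, (u N x : EReal)) + (K x : EReal) := by
    intro ε hε
    -- A Dini argument: otherwise the nested compact sets `Z N` have a common point, where the limit
    -- is at most `h - ε`, against the boundary hypothesis.
    obtain ⟨N, hN⟩ : ∃ N, ∀ x ∈ frontier D, h x ≤ u N x + K x + ε := by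
      by_contra! hcon
      set Z : ℕ → Set 𝔼 := fun N => frontier D ∩
        (fun x => h x - (u N x + K x + ε)) ⁻¹' Set.Ici 0 with hZ
      have hZc : ∀ N, IsClosed (Z N) := fun N =>
        ((hhc.mono frontier_subset_closure).sub ((((hu N).1.continuous.add hKc).add
          continuous_const).continuousOn)).preimage_isClosed_of_isClosed isClosed_frontier
            isClosed_Ici
      obtain ⟨x, hx⟩ := IsCompact.nonempty_iInter_of_sequence_nonempty_isCompact_isClosed Z
        (fun N x hx => ⟨hx.1, by
          have h1 : 0 ≤ h x - (u (N + 1) x + K x + ε) := hx.2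
          have h2 := hum x (frontier_subset_closure hx.1) N.le_succ
          simp only at h2
          change 0 ≤ h x - (u N x + K x + ε)
          have h3 : u N x ≤ u (N + 1) x := h2
          linarith⟩)
        (fun N => by
          obtain ⟨x, hx1, hx2⟩ := hcon N
          exact ⟨x, hx1, sub_nonneg.2 hx2.le⟩)
        (hDc.of_isClosed_subset (hZc 0) fun x hx => frontier_subset_closure hx.1) hZc
      rw [Set.mem_iInter] at hx
      have hxf := (hx 0).1
      have h1 : (⨆ N, (u N x : EReal)) + (K x : EReal) ≤ ((h x - ε : ℝ) : EReal) :=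
        le_of_tendsto' (hlim x (frontier_subset_closure hxf)) fun N => by
          have h2 : 0 ≤ h x - (u N x + K x + ε) := (hx N).2
          exact EReal.coe_le_coe_iff.2 (by linarith)
      have h2 := EReal.coe_le_coe_iff.1 ((hb x hxf).trans h1)
      linarith
    obtain ⟨K', hK's, hK'c, hK'⟩ := exists_smooth_concaveOn_approx hK hDc hε
    -- One `ε` comes from the choice of `N`, one from `K'` on the frontier; returning from `K'` to
    -- `K` inside costs the third.
    have hw : IsDominative fun x => u N x + K' x + 2 * ε :=
      ((hu N).add (isDominative_of_concaveOn hn hK's hK'c)).add (isDominative_const _)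
    have hcomp := (hw.isSmoothSupersolution hn).comparison hn' (by omega) hD hDc hhc hh
      fun x hx => by
        have h1 := abs_le.1 (hK' x (frontier_subset_closure hx))
        linarith [hN x hx, h1.1]
    intro x hx
    have h1 := abs_le.1 (hK' x (subset_closure hx))
    have h2 := hcomp x hx
    have h3 : ((h x - 3 * ε : ℝ) : EReal) ≤ ((u N x : ℝ) : EReal) + (K x : EReal) := by
      rw [← EReal.coe_add]
      exact EReal.coe_le_coe_iff.2 (by linarith [h1.2])
    exact h3.trans (add_le_add_left (le_iSup (fun N => (u N x : EReal)) N) _)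
  intro x hx
  refine le_of_forall_lt_imp_le_of_dense fun r hr => ?_
  induction r using EReal.rec with
  | bot => exact bot_le
  | top => exact absurd hr not_top_lt
  | coe r =>
    have hr' : r < h x := EReal.coe_lt_coe_iff.1 hr
    have := key ((h x - r) / 3) (by linarith) x hx
    rwa [show h x - 3 * ((h x - r) / 3) = r by ring] at this

end EuclideanSpace

end PLaplace

/-! ### The main theorem. -/

theorem mainTheorem4 (n : ℕ) (hn : 2 ≤ n) (a : ℕ → ℝ) (ha : ∀ i, 0 ≤ a i) (hA : Summable a)
    (y : ℕ → EuclideanSpace ℝ (Fin n)) (K : EuclideanSpace ℝ (Fin n) → ℝ)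
    (hK : ConcaveOn ℝ Set.univ K)
    (hconv : ∃ x₀ : EuclideanSpace ℝ (Fin n), (∀ i, 0 < a i → x₀ ≠ y i) ∧
      Summable (fun i => a i * |Real.log ‖x₀ - y i‖|)) :
    (∀ x : EuclideanSpace ℝ (Fin n),
      Summable (fun i => (a i : EReal) * PLaplace.negLogDist x (y i))) ∧
    PLaplace.IsPSuperharmonicOn (n : ℝ) Set.univ
      (fun x => (∑' i, (a i : EReal) * PLaplace.negLogDist x (y i)) + (K x : EReal)) := by
  obtain ⟨x₀, hx₀, hs⟩ := hconv
  -- The approximants depend on the radius, so each claim picks its own: `‖x‖` for pointwise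
  -- statements, `‖x‖ + 1` to cover a neighbourhood, and a bound of `closure D` for comparison.
  have happ := PLaplace.exists_dominative_approx hn ha hA hx₀ hs
  have hKc : Continuous K := hK.locallyLipschitz.continuous
  refine ⟨fun x => ?_, fun x _ => ?_, ⟨x₀, Set.mem_univ _, ?_⟩, fun x _ m hm => ?_,
    fun D hD hDc _ h hhc hh hb => ?_⟩
  · obtain ⟨u, -, hu⟩ := happ ‖x‖
    exact (hu x le_rfl).2.summable
  · obtain ⟨u, -, hu⟩ := happ ‖x‖
    rw [(hu x le_rfl).2.tsum_eq, EReal.add_ne_bot_iff]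
    refine ⟨fun h0 => ?_, EReal.coe_ne_bot _⟩
    exact EReal.coe_ne_bot (u 0 x) (le_bot_iff.1 (h0 ▸ le_iSup (fun N => (u N x : EReal)) 0))
  · have h1 : HasSum (fun i => (a i : EReal) * PLaplace.negLogDist x₀ (y i))
        ((∑' i, a i * -Real.log ‖x₀ - y i‖ : ℝ) : EReal) := by
      have h2 : Summable fun i => a i * -Real.log ‖x₀ - y i‖ := by
        refine Summable.of_norm (hs.congr fun i => ?_)
        rw [norm_mul, norm_neg, Real.norm_of_nonneg (ha i), Real.norm_eq_abs]
      convert PLaplace.hasSum_coe_ereal h2.hasSum using 2 with i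
      rcases (ha i).eq_or_lt with h | h
      · simp [← h]
      · rw [PLaplace.negLogDist, if_neg (hx₀ i h), EReal.coe_mul]
    rw [h1.tsum_eq]
    exact EReal.add_ne_top (EReal.coe_ne_top _) (EReal.coe_ne_top _)
  -- Near `x` the function is a supremum of continuous functions: one approximant exceeding `m` at
  -- `x` does so nearby and lies below the series.
  · obtain ⟨u, hud, hu⟩ := happ (‖x‖ + 1)
    have hx : ‖x‖ ≤ ‖x‖ + 1 := by linarith
    simp only [(hu x hx).2.tsum_eq] at hm
    have h1 : Filter.Tendsto (fun N => (u N x : EReal)) Filter.atTop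
        (nhds (⨆ N, (u N x : EReal))) :=
      tendsto_atTop_iSup fun N M h => EReal.coe_le_coe_iff.2 ((hu x hx).1 h)
    obtain ⟨N, hN⟩ := ((PLaplace.tendsto_add_coe_ereal h1
      (tendsto_const_nhds (x := (K x : EReal)))).eventually (lt_mem_nhds hm)).exists
    have hc : Continuous fun z => ((u N z + K z : ℝ) : EReal) :=
      continuous_coe_real_ereal.comp ((hud N).1.continuous.add hKc)
    rw [← EReal.coe_add] at hN
    rw [nhdsWithin_univ]
    filter_upwards [hc.continuousAt.eventually (lt_mem_nhds hN),
      continuous_norm.continuousAt.eventually (gt_mem_nhds (lt_add_one ‖x‖))] with z hz1 hz2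
    rw [(hu z hz2.le).2.tsum_eq]
    refine hz1.trans_le ?_
    rw [EReal.coe_add]
    exact add_le_add_left (le_iSup (fun N => (u N z : EReal)) N) _
  · obtain ⟨R, hR⟩ := hDc.isBounded.exists_norm_le
    obtain ⟨u, hud, hu⟩ := happ R
    intro x hx
    rw [(hu x (hR x (subset_closure hx))).2.tsum_eq]
    refine PLaplace.comparison_of_iSup_dominative hn hud hK hD hDc (fun z hz => (hu z (hR z hz)).1)
      hhc hh (fun z hz => ?_) x hx
    rw [← (hu z (hR z (frontier_subset_closure hz))).2.tsum_eq]
    exact hb z hz
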